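/- For a finite simple graph $G$ on $n$ vertices with degree matrix $D(G)$ and adjacency matrix $A(G)$, let $Q(G)=D(G)+A(G)$ be its signless Laplacian matrix and define the signless Laplacian coefficients $\varphi_0(G),\dots,\varphi_n(G)$ by $$\det(xI-Q(G))=\sum_{i=0}^{n}(-1)^i\varphi_i(G)\,x^{n-i}.$$ Let $n\ge 6$ and let $G$ be an $n$-vertex unicyclic graph (a connected graph with $n$ edges) whose unique cycle has length $g\ge 5$. A pendent path of length $k\ge1$ attached to a vertex $a$ is a path $a v_1\cdots v_k$ with $d(a)\ge 3$, $d(v_1)=\dots=d(v_{k-1})=2$ and $d(v_k)=1$. Assume that only pendent paths of length at most $2$ are attached to the cycle of $G$, that is, every vertex not on the cycle lies on a pendent path of length at most $2$ attached to a vertex of the cycle. Let $u,v,w$ be distinct vertices of the cycle with $u\sim v$ and $v\sim w$, write $$N_G(v)=\{u,w,v_1,v_2,\dots\},\qquad N_G(w)=\{v,w_1,w_2,\dots\},$$ and let $$G'=G-\{ww_1,ww_2,\dots,vv_1,vv_2,\dots\}+\{uw_1,uw_2,\dots,uv_1,uv_2,\dots\}.$$ Then $$\varphi_i(G)\ \ge\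 \varphi_i(G')\qquad\text{for all } i=0,1,\dots,n,$$ and equality holds if and only if $i\in\{0,1,n\}$, or $n=6$, $g=5$ and $i=5$. -/

import Mathlib

namespace SimpleGraph

/-- A unicyclic graph: connected, with as many edges as vertices. -/
def IsUnicyclic {V : Type*} [Fintype V] (G : SimpleGraph V) : Prop :=
  G.Connected ∧ G.edgeSet.ncard = Fintype.card V

/-- The vertex `x` lies on a cycle of `G`. For a unicyclic graph this says that
`x` is a vertex of its unique cycle. -/
def OnCycle {V : Type*} (G : SimpleGraph V) (x : V) : Prop :=
  ∃ c : G.Walk x x, c.IsCycle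

open Classical in
/-- The walk `p = a v₁ v₂ ⋯ v_k` is a pendent path of length `k ≥ 1` attached to `a`:
a path with `d(v₁) = ⋯ = d(v_{k-1}) = 2`, `d(v_k) = 1` and `d(a) ≥ 3`. -/
def IsPendentPath {V : Type*} [Fintype V] (G : SimpleGraph V) {a b : V}
    (p : G.Walk a b) : Prop :=
  p.IsPath ∧ 1 ≤ p.length ∧ 3 ≤ G.degree a ∧ G.degree b = 1 ∧
    ∀ j, 0 < j → j < p.length → G.degree (p.getVert j) = 2

/-- Only pendent paths of length at most `k` are attached to the cycle: every vertex off the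
cycle lies on a pendent path of length at most `k` attached to a vertex of the cycle. -/
def OnlyPendentPathsOnCycle {V : Type*} [Fintype V] (G : SimpleGraph V) (k : ℕ) : Prop :=
  ∀ x, ¬ G.OnCycle x → ∃ (a b : V) (p : G.Walk a b),
    G.OnCycle a ∧ G.IsPendentPath p ∧ p.length ≤ k ∧ x ∈ p.support

/-- For `N(v) = {u, w, v₁, v₂, …}` and `N(w) = {v, w₁, w₂, …}`, the graph
`G - {w w₁, w w₂, …, v v₁, v v₂, …} + {u w₁, u w₂, …, u v₁, u v₂, …}`. -/
def moveBranches {V : Type*} (G : SimpleGraph V) (u v w : V) : SimpleGraph V :=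
  G.deleteEdges
      ({e | ∃ x ∈ G.neighborSet w \ {v}, e = s(w, x)} ∪
        {e | ∃ x ∈ G.neighborSet v \ {u, w}, e = s(v, x)}) ⊔
    fromEdgeSet
      ({e | ∃ x ∈ G.neighborSet w \ {v}, e = s(u, x)} ∪
        {e | ∃ x ∈ G.neighborSet v \ {u, w}, e = s(u, x)})

open Classical in
/-- The signless Laplacian matrix `Q(G) = D(G) + A(G)`. -/
noncomputable def signlessLapMatrix {V : Type*} [Fintype V] (G : SimpleGraph V) :
    Matrix V V ℝ :=
  G.degMatrix ℝ + G.adjMatrix ℝ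

open Classical in
/-- The signless Laplacian coefficient `φ_i(G)`, for `0 ≤ i ≤ n`, where
`det (x I - Q(G)) = ∑ i, (-1) ^ i * φ_i(G) * x ^ (n - i)`. -/
noncomputable def signlessLapCoeff {V : Type*} [Fintype V] (G : SimpleGraph V) (i : ℕ) : ℝ :=
  (-1) ^ i * G.signlessLapMatrix.charpoly.coeff (Fintype.card V - i)

end SimpleGraph

/-! Since `∑ i, φ_i(G) t ^ i = det (1 + t Q(G))`, and `Q(G)` is the sum of the rank one matrices of
the edges of `G`, it is natural to study `det (D + t L)`, where `D` is diagonal and `L` is a sum of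
matrices of signed edges: adding an edge to `L` obeys a deletion–contraction rule, in which the
contraction adds up the two masses in `D` and reverses the sign of some of the edges.

Write `Q(G)` as the path `u v w` plus the rest. In `Q(G')` everything in the rest that is attached
to `v` or `w` is attached to `u` instead. As long as one end of the new edge lies outside of the
path, the rule is the same for both graphs, hence it also holds for the difference of the two
determinants. Peeling off pendent trees, and then the edges of the cycle one by one, reduces this
difference to paths and squares, where it is an explicit polynomial in `t` and the masses.

The coefficients obtained in this way are nonnegative, and positive in the degrees from `2` to
`n - 1`, except for the pentagon, which contributes `2 (n - 6)` in degree `n - 1`: this is negative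
for the bare pentagon, absorbed when the next vertex is added, and zero when `n = 6`.
-/

open Matrix Polynomial

section LinearAlgebra

theorem mul_vecMulVec_mul_transpose {V R : Type*} [Fintype V] [CommRing R] (M : Matrix V V R)
    (b : V → R) :
    M * vecMulVec b b * Mᵀ = vecMulVec (M *ᵥ b) (M *ᵥ b) := by
  rw [mul_vecMulVec, vecMulVec_mul, vecMul_transpose]

variable {V R : Type*} [DecidableEq V] [CommRing R]

/-- The signless Laplacian matrix of the edge `xy` with sign `σ`: the matrix of the quadratic form
`(X x + σ * X y) ^ 2`. -/
def signedEdge (σ : R) (x y : V) : Matrix V V R :=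
  vecMulVec (Pi.single x 1 + Pi.single y σ) (Pi.single x 1 + Pi.single y σ)

theorem signedEdge_comm (x y : V) : (signedEdge 1 x y : Matrix V V R) = signedEdge 1 y x := by
  rw [signedEdge, signedEdge, add_comm]

theorem signedEdge_swap {σ : R} (hσ : σ * σ = 1) (x y : V) :
    signedEdge σ x y = signedEdge σ y x := by
  have h : (Pi.single x 1 + Pi.single y σ : V → R) = σ • (Pi.single y 1 + Pi.single x σ) := by
    rw [smul_add, ← Pi.single_smul, ← Pi.single_smul, smul_eq_mul, smul_eq_mul, hσ, mul_one,
      add_comm]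
  rw [signedEdge, h, smul_vecMulVec, vecMulVec_smul, smul_smul, hσ, one_smul, signedEdge]

/-- The excess masses after the vertex `y`, of mass `1 + a y`, has been absorbed by `z`. -/
def merge (y z : V) (a : V → ℕ) : V → ℕ :=
  Function.update (Function.update a z (a z + a y + 1)) y 0

variable [Fintype V]

theorem det_add_smul_single_self (B : Matrix V V R) (t : R) (y : V) :
    (B + t • single y y 1).det = B.det + t * (B.updateRow y (Pi.single y 1)).det := by
  have hrow : B + t • single y y 1 = B.updateRow y (B y + t • Pi.single y 1) := by
    ext i j
    rcases eq_or_ne i y with rfl | hi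
    · simp [single_apply, Pi.single_apply, eq_comm]
    · simp [hi, hi.symm]
  rw [hrow, det_updateRow_add, updateRow_eq_self, det_updateRow_smul]

theorem det_updateRow_single_self (B : Matrix V V R) (y : V) :
    (B.updateRow y (Pi.single y 1)).det =
      ((1 - single y y 1) * B * (1 - single y y 1) + single y y 1).det := by
  have hdiag : (1 - single y y 1 : Matrix V V R) = diagonal fun i => if i = y then 0 else 1 := by
    ext i j
    simp only [Matrix.sub_apply, one_apply, single_apply, diagonal_apply]
    grind
  refine det_eq_of_forall_row_eq_smul_add_const (fun i => if i = y then 0 else B i y) y (by simp)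
    fun i j => ?_
  simp only [hdiag, Matrix.add_apply, mul_diagonal, diagonal_mul, updateRow_apply, single_apply,
    Pi.single_apply]
  grind

theorem det_add_smul_vecMulVec_self (A : Matrix V V R) (t : R) {b : V → R} {y : V} (hb : b y = 1) :
    (A + t • vecMulVec b b).det = A.det + t *
      ((1 - vecMulVec b (Pi.single y 1)) * A * (1 - vecMulVec b (Pi.single y 1))ᵀ +
        single y y 1).det := by
  set U : Matrix V V R := 1 - vecMulVec (b - Pi.single y 1) (Pi.single y 1) with hU
  have hdet : U.det = 1 := by
    rw [hU, sub_eq_add_neg, ← neg_vecMulVec, vecMulVec_eq Unit,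
      det_one_add_replicateCol_mul_replicateRow]
    simp [hb]
  have hUb : U *ᵥ b = Pi.single y 1 := by
    simp [U, sub_mulVec, vecMulVec_mulVec, hb]
  have hF : 1 - vecMulVec b (Pi.single y 1) = (1 - single y y 1) * U := by
    simp [U, sub_mul, mul_sub, sub_vecMulVec, single_eq_single_vecMulVec_single,
      vecMulVec_mul_vecMulVec, hb]
  have hcongr (M : Matrix V V R) : (U * M * Uᵀ).det = M.det := by simp [hdet]
  have hrank : U * (A + t • vecMulVec b b) * Uᵀ = U * A * Uᵀ + t • single y y 1 := by
    rw [mul_add, add_mul, Matrix.mul_smul, Matrix.smul_mul, mul_vecMulVec, vecMulVec_mul,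
      vecMul_transpose, hUb, single_eq_single_vecMulVec_single]
  clear_value U
  rw [← hcongr, hrank, det_add_smul_single_self, hcongr, det_updateRow_single_self, hF,
    transpose_mul, transpose_sub, transpose_one, transpose_single]
  simp only [Matrix.mul_assoc]

/-- The matrix of the substitution `Pi.single y 1 ↦ Pi.single z (-σ)`, which contracts the edge
`yz` of sign `σ` into its end `z`. -/
def contraction (σ : R) (y z : V) : Matrix V V R :=
  1 - vecMulVec (Pi.single y 1 + Pi.single z σ) (Pi.single y 1)

/-- The determinant of `D + t L`, where `D` gives the vertex `x` the mass `1 + a x`. -/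
def lapDet (t : R) (L : Matrix V V R) (a : V → ℕ) : R :=
  (diagonal (fun x => 1 + (a x : R)) + t • L).det

theorem contraction_mulVec_single_of_ne {σ c : R} {x y z : V} (h : x ≠ y) :
    contraction σ y z *ᵥ Pi.single x c = Pi.single x c := by
  rw [contraction, sub_mulVec, one_mulVec, vecMulVec_mulVec]
  simp [h.symm]

theorem contraction_mulVec_single_self {σ c : R} {y z : V} :
    contraction σ y z *ᵥ Pi.single y c = Pi.single z (-(σ * c)) := by
  rw [contraction, sub_mulVec, one_mulVec, vecMulVec_mulVec]
  ext x
  simp [Pi.single_apply]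
  grind

theorem contraction_mul_diagonal {σ : R} (hσ : σ * σ = 1) {y z : V} (hyz : y ≠ z) (a : V → ℕ) :
    contraction σ y z * diagonal (fun x => 1 + (a x : R)) * (contraction σ y z)ᵀ +
      single y y 1 = diagonal fun x => 1 + (merge y z a x : R) := by
  ext i j
  have hrow (b d : V → R) : ((1 - vecMulVec b (Pi.single y 1)) * diagonal d *
      (1 - vecMulVec b (Pi.single y 1))ᵀ : Matrix V V R) i j =
      (if i = j then d i else 0) - (if i = y then d y else 0) * b j -
        b i * (if j = y then d y else 0) + d y * b i * b j := by
    rw [mul_apply]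
    simp only [mul_diagonal, transpose_apply, Matrix.sub_apply, one_apply, vecMulVec_apply,
      Pi.single_apply, mul_ite, ite_mul, mul_one, mul_zero, sub_mul, mul_sub, one_mul, zero_mul,
      Finset.sum_sub_distrib, Finset.sum_ite_eq, Finset.sum_ite_eq', Finset.mem_univ, if_true]
    grind
  rw [Matrix.add_apply, contraction, hrow, single_apply, diagonal_apply]
  simp only [Pi.add_apply, Pi.single_apply, merge, Function.update_apply, Nat.cast_ite,
    Nat.cast_add, Nat.cast_zero, Nat.cast_one]
  clear hrow
  grind

theorem lapDet_add_signedEdge (t : R) (L : Matrix V V R) (a : V → ℕ) {σ : R} (hσ : σ * σ = 1)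
    {y z : V} (hyz : y ≠ z) :
    lapDet t (L + signedEdge σ y z) a = lapDet t L a +
      t * lapDet t (contraction σ y z * L * (contraction σ y z)ᵀ) (merge y z a) := by
  have hb : (Pi.single y 1 + Pi.single z σ : V → R) y = 1 := by simp [hyz]
  rw [lapDet, smul_add, ← add_assoc, signedEdge, det_add_smul_vecMulVec_self _ _ hb, lapDet, lapDet,
    ← contraction_mul_diagonal hσ hyz, ← contraction]
  congr 3
  simp only [mul_add, add_mul, Matrix.mul_smul, Matrix.smul_mul]
  abel

theorem contraction_conj_signedEdge_of_ne {σ τ : R} {x x' y z : V} (hx : x ≠ y) (hx' : x' ≠ y) :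
    contraction σ y z * signedEdge τ x x' * (contraction σ y z)ᵀ = signedEdge τ x x' := by
  rw [signedEdge, mul_vecMulVec_mul_transpose, mulVec_add, contraction_mulVec_single_of_ne hx,
    contraction_mulVec_single_of_ne hx']

theorem contraction_conj_signedEdge {σ τ : R} {x y z : V} (hx : x ≠ y) :
    contraction σ y z * signedEdge τ x y * (contraction σ y z)ᵀ = signedEdge (-(σ * τ)) x z := by
  rw [signedEdge, mul_vecMulVec_mul_transpose, mulVec_add, contraction_mulVec_single_of_ne hx,
    contraction_mulVec_single_self, signedEdge]

end LinearAlgebra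

section Fold

variable {V R : Type*} [DecidableEq V] [CommRing R] {u v w : V}

/-- The map identifying `v` and `w` with `u`. -/
def foldVertex (u v w x : V) : V := if x = v ∨ x = w then u else x

theorem foldVertex_of_notMem {x : V} (hx : x ∉ ({u, v, w} : Finset V)) :
    foldVertex u v w x = x := by
  grind [foldVertex]

/-- The excess masses after those of `v` and `w` have been moved to `u`. -/
def foldMass (u v w : V) (a : V → ℕ) (x : V) : ℕ :=
  if x = u then a u + a v + a w else if x = v ∨ x = w then 0 else a x

theorem merge_foldVertex_foldMass {y z : V} (huv : u ≠ v) (hvw : v ≠ w) (huw : u ≠ w)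
    (hy : y ∉ ({u, v, w} : Finset V)) (a : V → ℕ) :
    merge y (foldVertex u v w z) (foldMass u v w a) = foldMass u v w (merge y z a) := by
  funext x
  simp only [merge, foldMass, foldVertex, Function.update_apply]
  grind

variable [Fintype V]

/-- The matrix of the linear map sending `Pi.single x 1` to `Pi.single (foldVertex u v w x) 1`. -/
def foldMatrix (R : Type*) [CommRing R] (u v w : V) : Matrix V V R :=
  Matrix.of fun x y => if foldVertex u v w y = x then 1 else 0

/-- The signless Laplacian matrix of the path `u v w`. -/
def basePath (R : Type*) [CommRing R] (u v w : V) : Matrix V V R :=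
  signedEdge 1 u v + signedEdge 1 v w

/-- The change of `lapDet` when everything attached to the path `u v w`, that is, the matrix `L`
and the excess masses `a`, is moved to `u`. -/
def foldGap (t : R) (u v w : V) (L : Matrix V V R) (a : V → ℕ) : R :=
  lapDet t (basePath R u v w + L) a -
    lapDet t (basePath R u v w + foldMatrix R u v w * L * (foldMatrix R u v w)ᵀ) (foldMass u v w a)

theorem foldMatrix_mulVec_single (x : V) (c : R) :
    foldMatrix R u v w *ᵥ Pi.single x c = Pi.single (foldVertex u v w x) c := by
  ext y
  simp [foldMatrix, Pi.single_apply, eq_comm]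

theorem foldMatrix_conj_signedEdge (σ : R) (x y : V) :
    foldMatrix R u v w * signedEdge σ x y * (foldMatrix R u v w)ᵀ =
      signedEdge σ (foldVertex u v w x) (foldVertex u v w y) := by
  rw [signedEdge, mul_vecMulVec_mul_transpose, mulVec_add, foldMatrix_mulVec_single,
    foldMatrix_mulVec_single, signedEdge]

theorem contraction_foldVertex_mul_foldMatrix (σ : R) {y : V} (hy : y ∉ ({u, v, w} : Finset V))
    (z : V) :
    contraction σ y (foldVertex u v w z) * foldMatrix R u v w =
      foldMatrix R u v w * contraction σ y z := by
  refine ext_of_mulVec_single fun x => ?_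
  rw [← mulVec_mulVec, ← mulVec_mulVec, foldMatrix_mulVec_single]
  rcases eq_or_ne x y with rfl | hxy
  · rw [foldVertex_of_notMem hy, contraction_mulVec_single_self, contraction_mulVec_single_self,
      foldMatrix_mulVec_single]
  · have hne : foldVertex u v w x ≠ y := by grind [foldVertex]
    rw [contraction_mulVec_single_of_ne hne, contraction_mulVec_single_of_ne hxy,
      foldMatrix_mulVec_single]

theorem contraction_conj_basePath (σ : R) {y : V} (hy : y ∉ ({u, v, w} : Finset V)) (z : V) :
    contraction σ y z * basePath R u v w * (contraction σ y z)ᵀ = basePath R u v w := by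
  simp only [Finset.mem_insert, Finset.mem_singleton, not_or] at hy
  rw [basePath, mul_add, add_mul, contraction_conj_signedEdge_of_ne (Ne.symm hy.1) (Ne.symm hy.2.1),
    contraction_conj_signedEdge_of_ne (Ne.symm hy.2.1) (Ne.symm hy.2.2)]

theorem foldGap_add_signedEdge (t : R) (huv : u ≠ v) (hvw : v ≠ w) (huw : u ≠ w) (L : Matrix V V R)
    (a : V → ℕ) {σ : R} (hσ : σ * σ = 1) {y z : V} (hy : y ∉ ({u, v, w} : Finset V)) (hyz : y ≠ z) :
    foldGap t u v w (L + signedEdge σ y z) a = foldGap t u v w L a +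
      t * foldGap t u v w (contraction σ y z * L * (contraction σ y z)ᵀ) (merge y z a) := by
  have hyz' : y ≠ foldVertex u v w z := by grind [foldVertex]
  have hconj : contraction σ y (foldVertex u v w z) *
        (basePath R u v w + foldMatrix R u v w * L * (foldMatrix R u v w)ᵀ) *
          (contraction σ y (foldVertex u v w z))ᵀ =
      basePath R u v w + foldMatrix R u v w *
        (contraction σ y z * L * (contraction σ y z)ᵀ) * (foldMatrix R u v w)ᵀ := by
    have h := contraction_foldVertex_mul_foldMatrix (R := R) σ hy z
    rw [mul_add, add_mul, contraction_conj_basePath σ hy, ← mul_assoc, ← mul_assoc, h,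
      mul_assoc _ _ (_)ᵀ, ← transpose_mul, h, transpose_mul]
    simp only [mul_assoc]
  rw [foldGap, mul_add, add_mul, foldMatrix_conj_signedEdge, foldVertex_of_notMem hy, ← add_assoc,
    ← add_assoc, lapDet_add_signedEdge _ _ _ hσ hyz, lapDet_add_signedEdge _ _ _ hσ hyz', hconj,
    merge_foldVertex_foldMass huv hvw huw hy, mul_add, add_mul, contraction_conj_basePath σ hy,
    foldGap, foldGap]
  ring

end Fold

section BaseCases

theorem det_eq_det_submatrix_mul_prod {m V R : Type*} [Fintype m] [DecidableEq m] [Fintype V]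
    [DecidableEq V] [CommRing R] (M : Matrix V V R) {f : m → V} (hf : f.Injective)
    (hM : ∀ i ∉ Finset.univ.image f, ∀ j, i ≠ j → M i j = 0) :
    M.det = (M.submatrix f f).det * ∏ i ∈ (Finset.univ.image f)ᶜ, M i i := by
  rw [twoBlockTriangular_det M (· ∈ Finset.univ.image f) fun i hi j hj => hM i hi j (by grind)]
  congr 1
  · let e : m ≃ {x // x ∈ Finset.univ.image f} :=
      (Equiv.ofInjective f hf).trans (Equiv.subtypeEquivRight fun x => by simp)
    convert (det_submatrix_equiv_self e (toSquareBlockProp M (· ∈ Finset.univ.image f))).symm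
    rfl
  · have hdiag : toSquareBlockProp M (· ∉ Finset.univ.image f) =
        diagonal fun i : {i // i ∉ Finset.univ.image f} => M i i := by
      ext i j
      rcases eq_or_ne i j with rfl | hij
      · rw [diagonal_apply_eq]
        rfl
      · rw [diagonal_apply_ne _ hij]
        exact hM i i.2 j (Subtype.coe_ne_coe.2 hij)
    rw [hdiag, det_diagonal]
    exact (Finset.prod_subtype _ (fun x => Finset.mem_compl) fun i => M i i).symm

variable {V R : Type*} [Fintype V] [DecidableEq V] [CommRing R] {u v w : V}

/-- The product of the masses outside of `K`. -/
def offMass (K : Finset V) (a : V → ℕ) : ℕ := ∏ x ∈ Kᶜ, (1 + a x)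

theorem offMass_eq_mul_insert {K : Finset V} {y : V} (hy : y ∉ K) (a : V → ℕ) :
    offMass K a = (1 + a y) * offMass (insert y K) a := by
  rw [offMass, offMass, Finset.compl_insert]
  exact (Finset.mul_prod_erase _ _ (Finset.mem_compl.2 hy)).symm

theorem offMass_merge {K : Finset V} {y z : V} (hy : y ∉ K) (hz : z ∈ K) (a : V → ℕ) :
    offMass K (merge y z a) = offMass (insert y K) a := by
  rw [offMass_eq_mul_insert hy, offMass, offMass]
  have hy0 : merge y z a y = 0 := by simp [merge]
  rw [hy0, add_zero, one_mul]
  refine Finset.prod_congr rfl fun x hx => ?_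
  simp only [Finset.mem_compl, Finset.mem_insert, not_or] at hx
  have hxz : x ≠ z := fun h => hx.2 (h ▸ hz)
  simp [merge, hx.1, hxz]

theorem lapDet_basePath_add (t α γ : R) (huv : u ≠ v) (hvw : v ≠ w) (huw : u ≠ w) (a : V → ℕ) :
    lapDet t (basePath R u v w + vecMulVec (Pi.single u α + Pi.single w γ)
        (Pi.single u α + Pi.single w γ)) a =
      offMass {u, v, w} a *
        ((1 + a u + t * (1 + α * α)) * ((1 + a v + 2 * t) * (1 + a w + t * (1 + γ * γ)) - t * t) -
          t * (t * (1 + a w + t * (1 + γ * γ)) - t * (t * α * γ)) +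
          t * α * γ * (t * t - (1 + a v + 2 * t) * (t * α * γ))) := by
  set L := basePath R u v w + vecMulVec (Pi.single u α + Pi.single w γ)
    (Pi.single u α + Pi.single w γ) with hL
  have himage : Finset.univ.image ![u, v, w] = {u, v, w} := by
    ext x
    simp [Fin.exists_fin_succ, eq_comm]
  have hinj : Function.Injective ![u, v, w] := by
    intro i j
    fin_cases i <;> fin_cases j <;> simp [huv, hvw, huw, huv.symm, hvw.symm, huw.symm]
  have hL0 {x : V} (hx : x ∉ ({u, v, w} : Finset V)) (y : V) : L x y = 0 := by
    simp only [Finset.mem_insert, Finset.mem_singleton, not_or] at hx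
    simp [hL, basePath, signedEdge, vecMulVec_apply, hx]
  have hsub : (diagonal (fun x => 1 + (a x : R)) + t • L).submatrix ![u, v, w] ![u, v, w] =
      !![1 + a u + t * (1 + α * α), t, t * α * γ;
        t, 1 + a v + 2 * t, t;
        t * α * γ, t, 1 + a w + t * (1 + γ * γ)] := by
    ext i j
    fin_cases i <;> fin_cases j <;>
      simp [hL, basePath, signedEdge, vecMulVec_apply, huv, hvw, huw, huv.symm, hvw.symm,
        huw.symm] <;> ring
  rw [lapDet, det_eq_det_submatrix_mul_prod _ hinj, himage, hsub, det_fin_three, mul_comm]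
  · congr 1
    · rw [offMass, Nat.cast_prod]
      refine Finset.prod_congr rfl fun x hx => ?_
      simp [hL0 (Finset.mem_compl.1 hx)]
    · simp
      ring
  · rw [himage]
    intro x hx y hxy
    simp [hL0 hx, hxy]

theorem offMass_foldMass (a : V → ℕ) : offMass {u, v, w} (foldMass u v w a) = offMass {u, v, w} a :=
  Finset.prod_congr rfl fun x hx => by
    simp only [Finset.mem_compl, Finset.mem_insert, Finset.mem_singleton, not_or] at hx
    simp [foldMass, hx]

/-- The change of `lapDet` when excess masses `a`, `b`, `c` at the vertices of a path on three
vertices are moved to its first vertex. -/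
def baseGap (t a b c : R) : R :=
  a * b * c + a * b + b * c + c * a + t * (2 * a * c + a * b + b * c - b)

theorem foldGap_signedEdge_end (t : R) (huv : u ≠ v) (hvw : v ≠ w) (huw : u ≠ w) (a : V → ℕ)
    {τ : R} (hτ : τ * τ = 1) :
    foldGap t u v w (signedEdge τ w u) a = offMass {u, v, w} a *
      (baseGap t (a u) (a v) (a w) + t * ((2 + a u + a w) * (1 + a v) - (1 + τ) ^ 2) +
        t ^ 2 * (2 * (3 + a u + a v + a w) - 3 * (1 + τ) ^ 2)) := by
  have hclose : signedEdge τ w u =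
      vecMulVec (Pi.single u τ + Pi.single w 1) (Pi.single u τ + Pi.single w 1) := by
    rw [signedEdge, add_comm]
  have hloop : signedEdge τ u u =
      vecMulVec (Pi.single u (1 + τ) + Pi.single w 0) (Pi.single u (1 + τ) + Pi.single w 0) := by
    rw [signedEdge, ← Pi.single_add, Pi.single_zero, add_zero]
  have hw : foldVertex u v w w = u := by simp [foldVertex]
  have hu : foldVertex u v w u = u := by simp [foldVertex]
  rw [foldGap, foldMatrix_conj_signedEdge, hw, hu, hclose, hloop,
    lapDet_basePath_add _ _ _ huv hvw huw, lapDet_basePath_add _ _ _ huv hvw huw, offMass_foldMass]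
  simp only [foldMass, baseGap, if_true, if_neg huv.symm, if_neg huw.symm, true_or, or_true,
    Nat.cast_add, Nat.cast_zero]
  linear_combination (offMass {u, v, w} a *
    (t * (a v + a v * a w + a w + 1) + t ^ 2 * (a v + 2 * a w + 3)) : R) * hτ

theorem foldGap_zero (t : R) (huv : u ≠ v) (hvw : v ≠ w) (huw : u ≠ w) (a : V → ℕ) :
    foldGap t u v w 0 a = offMass {u, v, w} a * baseGap t (a u) (a v) (a w) := by
  have h0 : basePath R u v w + 0 = basePath R u v w +
      vecMulVec (Pi.single u 0 + Pi.single w 0) (Pi.single u 0 + Pi.single w 0) := by simp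
  rw [foldGap, mul_zero, zero_mul, h0, lapDet_basePath_add _ _ _ huv hvw huw,
    lapDet_basePath_add _ _ _ huv hvw huw, offMass_foldMass]
  simp only [foldMass, baseGap, if_true, if_neg huv.symm, if_neg huw.symm, true_or, or_true,
    Nat.cast_add, Nat.cast_zero]
  ring

end BaseCases

section PosUpTo

/-- The coefficients of `f` are nonnegative, positive in the degrees from `2` to `N`, and zero in
the degrees above `N`. -/
def PosUpTo (N : ℕ) (f : ℝ[X]) : Prop :=
  ∀ k, 0 ≤ f.coeff k ∧ (2 ≤ k → k ≤ N → 0 < f.coeff k) ∧ (N < k → f.coeff k = 0)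

theorem PosUpTo.add_C_mul_X_pow_add_X_mul {N : ℕ} {f g : ℝ[X]} {c : ℝ} (hN : 2 ≤ N)
    (hf : PosUpTo N f) (hg : PosUpTo N g) (hc : 0 < c + g.coeff N) :
    PosUpTo (N + 1) (f + C c * X ^ (N + 1) + X * g) := by
  rintro (_ | k)
  · simpa using (hf 0).1
  · obtain ⟨hf0, hfpos, hfzero⟩ := hf (k + 1)
    obtain ⟨hg0, hgpos, hgzero⟩ := hg k
    rw [coeff_add, coeff_add, coeff_C_mul_X_pow, coeff_X_mul]
    rcases lt_trichotomy k N with hk | rfl | hk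
    · rw [if_neg (by omega), add_zero]
      exact ⟨add_nonneg hf0 hg0, fun h2 _ => add_pos_of_pos_of_nonneg (hfpos h2 hk) hg0,
        fun h => by omega⟩
    · rw [if_pos rfl, hfzero (by omega), zero_add]
      exact ⟨hc.le, fun _ _ => hc, fun h => by omega⟩
    · rw [if_neg (by omega), hfzero (by omega), hgzero hk, add_zero, add_zero]
      exact ⟨le_rfl, fun _ h => by omega, fun _ => rfl⟩

theorem PosUpTo.add_X_mul {N : ℕ} {f g : ℝ[X]} (hN : 2 ≤ N) (hf : PosUpTo N f)
    (hg : PosUpTo N g) : PosUpTo (N + 1) (f + X * g) := by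
  simpa using hf.add_C_mul_X_pow_add_X_mul (c := 0) hN hg (by simpa using (hg N).2.1 hN le_rfl)

theorem PosUpTo.of_add_C_mul_X_pow {N : ℕ} {f : ℝ[X]} {c : ℝ} (hf : PosUpTo N f)
    (hc : 0 < c) : PosUpTo (N + 1) (f + C c * X ^ (N + 1)) := by
  intro k
  obtain ⟨h0, hpos, hzero⟩ := hf k
  rw [coeff_add, coeff_C_mul_X_pow]
  rcases lt_trichotomy k (N + 1) with hk | rfl | hk
  · rw [if_neg hk.ne, add_zero]
    exact ⟨h0, fun h2 _ => hpos h2 (by omega), fun h => by omega⟩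
  · rw [if_pos rfl, hzero (by omega), zero_add]
    exact ⟨hc.le, fun _ _ => hc, fun h => absurd h (lt_irrefl _)⟩
  · rw [if_neg hk.ne', add_zero]
    exact ⟨h0, fun _ h => by omega, fun _ => hzero (by omega)⟩

theorem coeff_natCast_mul_cubic (p c₀ c₁ c₂ c₃ k : ℕ) :
    ((p : ℝ[X]) * ((c₀ : ℝ[X]) + (c₁ : ℝ[X]) * X + (c₂ : ℝ[X]) * X ^ 2 +
      (c₃ : ℝ[X]) * X ^ 3)).coeff k =
      p * ((if k = 0 then (c₀ : ℝ) else 0) + (if k = 1 then (c₁ : ℝ) else 0) +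
        (if k = 2 then (c₂ : ℝ) else 0) + if k = 3 then (c₃ : ℝ) else 0) := by
  simp only [← C_eq_natCast, coeff_C_mul, coeff_add, coeff_C, coeff_X, coeff_X_pow, mul_ite,
    mul_one, mul_zero, eq_comm (a := 1) (b := k)]

theorem posUpTo_three {p c₀ c₁ c₂ c₃ : ℕ} (hp : 0 < p) (h₂ : 0 < c₂) (h₃ : 0 < c₃) :
    PosUpTo 3 ((p : ℝ[X]) * ((c₀ : ℝ[X]) + (c₁ : ℝ[X]) * X + (c₂ : ℝ[X]) * X ^ 2 +
      (c₃ : ℝ[X]) * X ^ 3)) := by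
  intro k
  rw [coeff_natCast_mul_cubic]
  refine ⟨by positivity, fun h2 hk => ?_, fun hk => ?_⟩
  · interval_cases k <;>
      simp only [OfNat.ofNat_ne_zero, OfNat.ofNat_ne_one, Nat.reduceEqDiff, if_true, if_false,
        add_zero, zero_add] <;>
      positivity
  · simp [show k ≠ 0 by omega, show k ≠ 1 by omega, show k ≠ 2 by omega, hk.ne']

end PosUpTo

section Contraction

variable {V R : Type*} [DecidableEq V] [CommRing R] {next : V → V} {S : Finset V}

/-- The signless Laplacian matrix of the edges from the vertices `x ∈ S` to `next x`. -/
def edgeSum (R : Type*) [CommRing R] (next : V → V) (S : Finset V) : Matrix V V R :=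
  ∑ x ∈ S, signedEdge 1 x (next x)

variable [Fintype V] {u v w y z : V}

theorem foldGap_edgeSum_insert (t : R) (huv : u ≠ v) (hvw : v ≠ w) (huw : u ≠ w)
    (hS : ∀ x ∈ S, next x ∈ S ∪ {u, v, w}) (hy : y ∉ S ∪ {u, v, w})
    (hnext : next y ∈ S ∪ {u, v, w}) (E : Matrix V V R) (a : V → ℕ) :
    foldGap t u v w (edgeSum R next (insert y S) + E) a = foldGap t u v w (edgeSum R next S + E) a +
      t * foldGap t u v w
        (edgeSum R next S + contraction 1 y (next y) * E * (contraction 1 y (next y))ᵀ)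
        (merge y (next y) a) := by
  obtain ⟨hyS, hyB⟩ := Finset.notMem_union.1 hy
  have hne : y ≠ next y := fun h => hy (h ▸ hnext)
  have hconj : contraction 1 y (next y) * edgeSum R next S * (contraction 1 y (next y))ᵀ =
      edgeSum R next S := by
    rw [edgeSum, Matrix.mul_sum, Matrix.sum_mul]
    refine Finset.sum_congr rfl fun x hx => contraction_conj_signedEdge_of_ne ?_ ?_
    · exact fun h => hyS (h ▸ hx)
    · exact fun h => hy (h ▸ hS x hx)
  rw [edgeSum, Finset.sum_insert hyS, ← edgeSum, add_comm (signedEdge _ _ _), add_right_comm,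
    foldGap_add_signedEdge t huv hvw huw _ _ (one_mul 1) hyB hne, mul_add, add_mul, hconj]

theorem foldGap_insert_leaf (t : R) (huv : u ≠ v) (hvw : v ≠ w) (huw : u ≠ w)
    (hS : ∀ x ∈ S, next x ∈ S ∪ {u, v, w}) (hy : y ∉ S ∪ {u, v, w})
    (hnext : next y ∈ S ∪ {u, v, w}) (hzy : z ≠ y) (σ : R) (a : V → ℕ) :
    foldGap t u v w (edgeSum R next (insert y S) + signedEdge σ w z) a =
      foldGap t u v w (edgeSum R next S + signedEdge σ w z) a +
        t * foldGap t u v w (edgeSum R next S + signedEdge σ w z) (merge y (next y) a) := by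
  have hwy : w ≠ y := by grind
  rw [foldGap_edgeSum_insert t huv hvw huw hS hy hnext, contraction_conj_signedEdge_of_ne hwy hzy]

theorem foldGap_insert_end (t : R) (huv : u ≠ v) (hvw : v ≠ w) (huw : u ≠ w)
    (hS : ∀ x ∈ S, next x ∈ S ∪ {u, v, w}) (hy : y ∉ S ∪ {u, v, w})
    (hnext : next y ∈ S ∪ {u, v, w}) (σ : R) (a : V → ℕ) :
    foldGap t u v w (edgeSum R next (insert y S) + signedEdge σ w y) a =
      foldGap t u v w (edgeSum R next S + signedEdge σ w y) a +
        t * foldGap t u v w (edgeSum R next S + signedEdge (-σ) w (next y))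
          (merge y (next y) a) := by
  have hwy : w ≠ y := by grind
  rw [foldGap_edgeSum_insert t huv hvw huw hS hy hnext, contraction_conj_signedEdge hwy, one_mul]

theorem foldGap_signedEdge_leaf (t : R) (huv : u ≠ v) (hvw : v ≠ w) (huw : u ≠ w)
    (hz : z ∉ ({u, v, w} : Finset V)) {σ : R} (hσ : σ * σ = 1) (a : V → ℕ) :
    foldGap t u v w (signedEdge σ w z) a =
      foldGap t u v w 0 a + t * foldGap t u v w 0 (merge z w a) := by
  have hzw : z ≠ w := by grind
  have h := foldGap_add_signedEdge t huv hvw huw 0 a hσ hz hzw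
  rwa [zero_add, mul_zero, zero_mul, ← signedEdge_swap hσ] at h

end Contraction

section SmallCycles

/-- The normalized gap of a path on five vertices whose middle vertices `u`, `v`, `w` have the
excess masses `a`, `b`, `c`, and whose ends next to `u` and `w` have the excess masses
`α` and `γ`. -/
def pathGap {R : Type*} [CommRing R] (t a b c α γ : R) : R :=
  (1 + α) * (1 + γ) * baseGap t a b c +
    t * ((1 + α) * baseGap t a b (c + γ + 1) + (1 + γ) * baseGap t (a + α + 1) b c) +
    t ^ 2 * baseGap t (a + α + 1) b (c + γ + 1)

/-- The normalized gap of a square with excess masses `a`, `b`, `c` at `u`, `v`, `w` and `κ` at its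
fourth vertex, which is joined to `w` by an edge of sign `-σ`. -/
def squareGap {R : Type*} [CommRing R] (t σ a b c κ : R) : R :=
  (1 + κ) * baseGap t a b c + t * (baseGap t a b (c + κ + 1) + baseGap t (a + κ + 1) b c +
    t * ((3 + a + κ + c) * (1 + b) - (1 + σ) ^ 2) +
    t ^ 2 * (2 * (4 + a + b + c + κ) - 3 * (1 + σ) ^ 2))

variable {V R : Type*} [Fintype V] [DecidableEq V] [CommRing R] {u v w x y z : V} {next : V → V}

theorem foldGap_path_five (t : R) (huv : u ≠ v) (hvw : v ≠ w) (huw : u ≠ w)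
    (hx : x ∉ ({u, v, w} : Finset V)) (hz : z ∉ insert x ({u, v, w} : Finset V))
    (hnext : next x = u) {σ : R} (hσ : σ * σ = 1) (a : V → ℕ) :
    foldGap t u v w (edgeSum R next {x} + signedEdge σ w z) a =
      offMass (insert z (insert x {u, v, w})) a *
        pathGap t (a u) (a v) (a w) (a x) (a z) := by
  simp only [Finset.mem_insert, Finset.mem_singleton, not_or] at hx hz
  obtain ⟨hxu, hxv, hxw⟩ := hx
  obtain ⟨hzx, hzu, hzv, hzw⟩ := hz
  have hzB : z ∉ ({u, v, w} : Finset V) := by simp [hzu, hzv, hzw]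
  have hempty : edgeSum R next ∅ = 0 := Finset.sum_empty
  have h := foldGap_insert_leaf (S := ∅) (next := next) t huv hvw huw (by simp) (y := x)
    (by simp [hxu, hxv, hxw]) (by simp [hnext]) hzx σ a
  rw [hempty, zero_add, hnext] at h
  have hmass : offMass {u, v, w} a =
      (1 + a x) * ((1 + a z) * offMass (insert z (insert x {u, v, w})) a) := by
    rw [offMass_eq_mul_insert (y := x) (by simp [*]), offMass_eq_mul_insert (y := z) (by simp [*])]
  have hmassx : offMass {u, v, w} (merge x u a) =
      (1 + a z) * offMass (insert z (insert x {u, v, w})) a := by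
    rw [offMass_merge (by simp [*]) (by simp), offMass_eq_mul_insert (y := z) (by simp [*])]
  have hmassz : offMass {u, v, w} (merge z w a) =
      (1 + a x) * offMass (insert z (insert x {u, v, w})) a := by
    rw [offMass_merge hzB (by simp), offMass_eq_mul_insert (y := x) (by simp [Ne.symm hzx, *]),
      Finset.insert_comm]
  have hmassxz : offMass {u, v, w} (merge z w (merge x u a)) =
      offMass (insert z (insert x {u, v, w})) a := by
    rw [offMass_merge hzB (by simp), offMass_merge (by simp [Ne.symm hzx, *]) (by simp),
      Finset.insert_comm]
  rw [← insert_empty_eq, h]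
  simp only [foldGap_signedEdge_leaf t huv hvw huw hzB hσ, foldGap_zero t huv hvw huw, hmass,
    hmassx, hmassz, hmassxz]
  simp only [merge, Function.update_apply, hzx, hzu, Ne.symm hxu, Ne.symm hxv, Ne.symm hxw,
    Ne.symm hzu, Ne.symm hzv, Ne.symm hzw, huw, huw.symm, huv.symm, hvw, if_true, if_false,
    Nat.cast_mul, Nat.cast_add, Nat.cast_one, pathGap]
  ring

theorem foldGap_square (t : R) (huv : u ≠ v) (hvw : v ≠ w) (huw : u ≠ w)
    (hx : x ∉ ({u, v, w} : Finset V)) (hnext : next x = u) {σ : R} (hσ : σ * σ = 1) (a : V → ℕ) :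
    foldGap t u v w (edgeSum R next {x} + signedEdge (-σ) w x) a =
      offMass (insert x {u, v, w}) a *
        squareGap t σ (a u) (a v) (a w) (a x) := by
  have hσ' : -σ * -σ = 1 := by rw [neg_mul_neg, hσ]
  have hempty : edgeSum R next ∅ = 0 := Finset.sum_empty
  have h := foldGap_insert_end (S := ∅) (next := next) t huv hvw huw (by simp) (y := x)
    (by simpa using hx) (by simp [hnext]) (-σ) a
  rw [hempty, zero_add, zero_add, hnext, neg_neg, foldGap_signedEdge_leaf t huv hvw huw hx hσ',
    foldGap_signedEdge_end t huv hvw huw _ hσ, foldGap_zero t huv hvw huw,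
    foldGap_zero t huv hvw huw, offMass_eq_mul_insert hx, offMass_merge hx (by simp),
    offMass_merge hx (by simp)] at h
  simp only [Finset.mem_insert, Finset.mem_singleton, not_or] at hx
  obtain ⟨hxu, hxv, hxw⟩ := hx
  rw [← insert_empty_eq, h]
  simp only [merge, Function.update_apply, Ne.symm hxu, Ne.symm hxv, Ne.symm hxw, huw, huw.symm,
    huv.symm, hvw, if_true, if_false, Nat.cast_mul, Nat.cast_add, Nat.cast_one,
    squareGap]
  ring

end SmallCycles

section SmallCyclesPositivity

theorem posUpTo_pathGap {p : ℕ} (hp : 0 < p) (a b c α γ : ℕ) :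
    PosUpTo 3 ((p : ℝ[X]) * pathGap (X : ℝ[X]) a b c α γ) := by
  convert posUpTo_three hp
    (c₀ := (1 + α) * (1 + γ) * (a * b * c + a * b + b * c + c * a))
    (c₁ := (1 + α) * (1 + γ) * (2 * a * c + a * b + b * c) +
      (1 + α) * (a * b * (c + γ + 1) + a * b + b * c + (c + γ + 1) * a) +
      (1 + γ) * ((a + α + 1) * b * c + (a + α + 1) * b + b * c + c * (a + α + 1)))
    (c₂ := (1 + α) * (2 * a * (c + γ + 1) + a * b + b * (c + γ + 1)) +
      (1 + γ) * (2 * (a + α + 1) * c + (a + α + 1) * b + b * c) +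
      ((a + α + 1) * b * (c + γ + 1) + a * b + b * c + (c + γ + 1) * (a + α + 1)))
    (c₃ := 2 * (a + α + 1) * (c + γ + 1) + a * b + α * b + b * (c + γ + 1))
    (by positivity) (by positivity) using 2
  simp only [pathGap, baseGap]
  push_cast
  ring

theorem posUpTo_squareGap {p : ℕ} (hp : 0 < p) (a b c κ : ℕ) :
    PosUpTo 3 ((p : ℝ[X]) * squareGap (X : ℝ[X]) (-1) a b c κ) := by
  convert posUpTo_three hp
    (c₀ := (1 + κ) * (a * b * c + a * b + b * c + c * a))
    (c₁ := (1 + κ) * (2 * a * c + a * b + b * c) +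
      (a * b * (c + κ + 1) + a * b + b * c + (c + κ + 1) * a) +
      ((a + κ + 1) * b * c + (a + κ + 1) * b + b * c + c * (a + κ + 1)))
    (c₂ := 2 * a * (c + κ + 1) + a * b + b * c + κ * b + 2 * (a + κ + 1) * c + a * b + κ * b +
      b * c + (3 + a + κ + c) * (1 + b))
    (c₃ := 2 * (4 + a + b + c + κ))
    (by positivity) (by positivity) using 2
  simp only [squareGap, baseGap]
  push_cast
  ring

theorem exists_posUpTo_pentagon {p : ℕ} (hp : 0 < p) (a b c α β : ℕ) :
    ∃ h, PosUpTo 3 h ∧ 2 * (p : ℝ) * ((β + (α + (a + (b + c))) : ℕ) : ℝ) < h.coeff 3 ∧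
      (p : ℝ[X]) * pathGap (X : ℝ[X]) a b c α β +
        X * ((p : ℝ[X]) * squareGap (X : ℝ[X]) 1 a b c ((α + β + 1 : ℕ) : ℝ[X])) =
      h + C (2 * (p : ℝ) * (((β + (α + (a + (b + c))) : ℕ) : ℝ) - 1)) * X ^ 4 := by
  let c₃ := 2 * (a + α + 1) * (c + β + 1) + a * b + α * b + b * (c + β + 1) +
    (2 * a * (c + α + β + 2) + a * b + b * c + (α + β + 1) * b + 2 * (a + α + β + 2) * c + a * b +
      (α + β + 1) * b + b * c + 4 * b + (a + α + β + c) * (1 + b))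
  refine ⟨_, posUpTo_three hp
    (c₀ := (1 + α) * (1 + β) * (a * b * c + a * b + b * c + c * a))
    (c₁ := (1 + α) * (1 + β) * (2 * a * c + a * b + b * c) +
      (1 + α) * (a * b * (c + β + 1) + a * b + b * c + (c + β + 1) * a) +
      (1 + β) * ((a + α + 1) * b * c + (a + α + 1) * b + b * c + c * (a + α + 1)) +
      (α + β + 2) * (a * b * c + a * b + b * c + c * a))
    (c₂ := (1 + α) * (2 * a * (c + β + 1) + a * b + b * (c + β + 1)) +
      (1 + β) * (2 * (a + α + 1) * c + (a + α + 1) * b + b * c) +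
      ((a + α + 1) * b * (c + β + 1) + a * b + b * c + (c + β + 1) * (a + α + 1)) +
      (α + β + 2) * (2 * a * c + a * b + b * c) +
      (a * b * (c + α + β + 2) + a * b + b * c + (c + α + β + 2) * a) +
      ((a + α + β + 2) * b * c + (a + α + β + 2) * b + b * c + c * (a + α + β + 2)))
    (c₃ := c₃) (by positivity) (by positivity), ?_, ?_⟩
  · have hc₃ : 2 * (β + (α + (a + (b + c)))) < c₃ := by
      simp only [c₃]
      nlinarith [Nat.zero_le (a * c), Nat.zero_le (α * β)]
    rw [coeff_natCast_mul_cubic, mul_comm 2 (p : ℝ), mul_assoc]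
    refine mul_lt_mul_of_pos_left ?_ (by exact_mod_cast hp)
    norm_num
    exact_mod_cast hc₃
  · simp only [c₃, pathGap, squareGap, baseGap, map_mul, map_sub, map_natCast, map_ofNat, map_one]
    push_cast
    ring

end SmallCyclesPositivity

section Pentagon

theorem sum_merge {V : Type*} [DecidableEq V] {y z : V} {K : Finset V} (hy : y ∉ K)
    (hz : z ∈ K) (a : V → ℕ) :
    ∑ x ∈ K, merge y z a x = ∑ x ∈ insert y K, a x + 1 := by
  have hrest : ∑ x ∈ K.erase z, merge y z a x = ∑ x ∈ K.erase z, a x :=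
    Finset.sum_congr rfl fun x hx => by
      obtain ⟨hxz, hxK⟩ := Finset.mem_erase.1 hx
      have hxy : x ≠ y := fun h => hy (h ▸ hxK)
      simp [merge, hxz, hxy]
  have hzy : z ≠ y := fun h => hy (h ▸ hz)
  rw [Finset.sum_insert hy, ← Finset.add_sum_erase K _ hz, ← Finset.add_sum_erase K _ hz, hrest]
  simp [merge, hzy]
  omega

variable {V R : Type*} [Fintype V] [DecidableEq V] [CommRing R] {u v w x y z : V} {next : V → V}

theorem offMass_pos (K : Finset V) (a : V → ℕ) : 0 < offMass K a :=
  Finset.prod_pos fun _ _ => by positivity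

theorem foldGap_pentagon (t : R) (huv : u ≠ v) (hvw : v ≠ w) (huw : u ≠ w)
    (hx : x ∉ ({u, v, w} : Finset V)) (hy : y ∉ insert x ({u, v, w} : Finset V))
    (hyx : next y = x) (hxu : next x = u) {σ : R} (hσ : σ * σ = 1) (a : V → ℕ) :
    foldGap t u v w (edgeSum R next (insert y {x}) + signedEdge σ w y) a =
      offMass (insert y (insert x {u, v, w})) a * pathGap t (a u) (a v) (a w) (a x) (a y) +
        t * (offMass (insert y (insert x {u, v, w})) a *
          squareGap t σ (a u) (a v) (a w) ((a x + a y + 1 : ℕ) : R)) := by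
  have hy' : y ∉ {x} ∪ ({u, v, w} : Finset V) := by rwa [Finset.singleton_union]
  rw [foldGap_insert_end t huv hvw huw (by simp [hxu]) hy' (by simp [hyx]), hyx,
    foldGap_path_five t huv hvw huw hx hy hxu hσ, foldGap_square t huv hvw huw hx hxu hσ,
    offMass_merge hy (by simp)]
  simp only [Finset.mem_insert, Finset.mem_singleton, not_or] at hx hy
  obtain ⟨hyx, hyu, hyv, hyw⟩ := hy
  simp [merge, Ne.symm hyx, Ne.symm hyu, Ne.symm hyv, Ne.symm hyw,
    Ne.symm hx.1, Ne.symm hx.2.1, Ne.symm hx.2.2]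

/-- The shape of the gap of a unicyclic graph of girth `5` on the vertex set `K`, with `N` vertices
outside of the base path: its top coefficient is explicit and may fail to be positive. The middle
condition lets the next coefficient absorb the top one, when that one is negative. -/
def PentagonShape (K : Finset V) (a : V → ℕ) (N : ℕ) (f : ℝ[X]) : Prop :=
  ∃ h, PosUpTo (N + 1) h ∧
    (N = 2 → 2 * (offMass K a : ℝ) * ((∑ x ∈ K, a x : ℕ) : ℝ) < h.coeff (N + 1)) ∧
    f = h + C (2 * (offMass K a : ℝ) * (((∑ x ∈ K, a x : ℕ) : ℝ) + N - 3)) * X ^ (N + 2)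

theorem pentagonShape_pentagon (huv : u ≠ v) (hvw : v ≠ w) (huw : u ≠ w)
    (hx : x ∉ ({u, v, w} : Finset V)) (hy : y ∉ insert x ({u, v, w} : Finset V))
    (hyx : next y = x) (hxu : next x = u) (a : V → ℕ) :
    PentagonShape (insert y (insert x {u, v, w})) a 2
      (foldGap X u v w (edgeSum ℝ[X] next (insert y {x}) + signedEdge 1 w y) a) := by
  obtain ⟨h, hpos, hlt, heq⟩ := exists_posUpTo_pentagon
    (offMass_pos (insert y (insert x {u, v, w})) a) (a u) (a v) (a w) (a x) (a y)
  have hsum : ∑ x ∈ insert y (insert x {u, v, w}), a x =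
      a y + (a x + (a u + (a v + a w))) := by
    rw [Finset.sum_insert hy, Finset.sum_insert hx, Finset.sum_insert (by simp [huv, huw]),
      Finset.sum_pair hvw]
  refine ⟨h, hpos, fun _ => by rwa [hsum], ?_⟩
  rw [foldGap_pentagon X huv hvw huw hx hy hyx hxu (one_mul 1), heq, hsum]
  congr 4
  push_cast
  ring

theorem PentagonShape.posUpTo {K : Finset V} {a : V → ℕ} {N : ℕ} {f : ℝ[X]}
    (hf : PentagonShape K a N f) (hN : 4 ≤ ∑ x ∈ K, a x + N) : PosUpTo (N + 2) f := by
  obtain ⟨h, hpos, -, rfl⟩ := hf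
  have hN' : (4 : ℝ) ≤ ((∑ x ∈ K, a x : ℕ) : ℝ) + N := by exact_mod_cast hN
  have hP : (0 : ℝ) < offMass K a := by exact_mod_cast offMass_pos K a
  exact hpos.of_add_C_mul_X_pow (mul_pos (by positivity) (by linarith))

theorem PentagonShape.add_X_mul {K : Finset V} {a : V → ℕ} {N : ℕ} {f g : ℝ[X]} (hN : 2 ≤ N)
    (hy : y ∉ K) (hz : z ∈ K) (hf : PentagonShape K a N f)
    (hg : PentagonShape K (merge y z a) N g) :
    PentagonShape (insert y K) a (N + 1) (f + X * g) := by
  obtain ⟨h, hpos, -, rfl⟩ := hf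
  obtain ⟨h', hpos', hlt, rfl⟩ := hg
  rw [PentagonShape, Finset.sum_insert hy, offMass_eq_mul_insert hy]
  rw [offMass_merge hy hz, sum_merge hy hz, Finset.sum_insert hy] at hlt ⊢
  have hP : (0 : ℝ) < offMass (insert y K) a := by exact_mod_cast offMass_pos _ a
  generalize offMass (insert y K) a = P at *
  generalize ∑ x ∈ K, a x = A at *
  set c : ℝ := 2 * (((1 + a y) * P : ℕ) : ℝ) * ((A : ℝ) + N - 3) with hc
  have hlead : 0 < c + h'.coeff (N + 1) := by
    have hpos_lead := (hpos' (N + 1)).2.1 (by omega) le_rfl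
    rcases hN.eq_or_lt with rfl | hN
    · have hlt := hlt rfl
      have hprod : (0 : ℝ) ≤ a y * P * A := by positivity
      push_cast at hc hlt
      nlinarith
    · have hN' : (3 : ℝ) ≤ N := by exact_mod_cast hN
      have hc0 : 0 ≤ c := mul_nonneg (by positivity) (by linarith [Nat.cast_nonneg (α := ℝ) A])
      linarith
  refine ⟨h + C c * X ^ (N + 2) + X * h',
    hpos.add_C_mul_X_pow_add_X_mul (by omega) hpos' hlead, fun _ => by omega, ?_⟩
  push_cast
  rw [show (a y + A + 1 + N - 3 : ℝ) = a y + A + (N + 1) - 3 by ring]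
  ring

end Pentagon

section Growth

variable {V : Type*} [DecidableEq V] {core S T : Finset V} {next : V → V} {r : V → ℕ} {u x y : V}

/-- `IsArc core next u S y`: the set `S`, disjoint from `core`, consists of the vertices of a path
`y, next y, next (next y), …` that ends when it reaches `u ∈ core`. -/
inductive IsArc (core : Finset V) (next : V → V) (u : V) : Finset V → V → Prop
  | nil : IsArc core next u ∅ u
  | cons {S : Finset V} {y : V} :
      IsArc core next u S (next y) → y ∉ S ∪ core → IsArc core next u (insert y S) y

/-- `GrowsTo core next S T`: the set `T` arises from `S` by successively adding vertices outside of
`core` whose image under `next` is already in the set or in `core`. -/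
inductive GrowsTo (core : Finset V) (next : V → V) (S : Finset V) : Finset V → Prop
  | refl : GrowsTo core next S S
  | insert {T : Finset V} {y : V} : GrowsTo core next S T → y ∉ T ∪ core → next y ∈ T ∪ core →
      GrowsTo core next S (insert y T)

theorem IsArc.eq_of_empty (h : IsArc core next u ∅ y) : y = u := by
  generalize hS : (∅ : Finset V) = S at h
  cases h with
  | nil => rfl
  | cons => exact absurd hS.symm (Finset.insert_ne_empty _ _)

theorem IsArc.disjoint (h : IsArc core next u S y) : Disjoint S core := by
  induction h with
  | nil => exact Finset.disjoint_empty_left _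
  | cons _ hy ih =>
    exact Finset.disjoint_insert_left.2 ⟨fun h => hy (Finset.mem_union_right _ h), ih⟩

theorem IsArc.exists_of_card_eq_succ {n : ℕ} (h : IsArc core next u S y) (hS : S.card = n + 1) :
    ∃ S', S = insert y S' ∧ S'.card = n ∧ y ∉ S' ∪ core ∧ IsArc core next u S' (next y) := by
  cases h with
  | nil => simp at hS
  | @cons S' _ h hy =>
    rw [Finset.card_insert_of_notMem (Finset.notMem_union.1 hy).1] at hS
    exact ⟨S', rfl, Nat.succ_injective hS, hy, h⟩

theorem IsArc.exists_of_card_eq_two (h : IsArc core next u S y) (hS : S.card = 2) :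
    ∃ x, S = insert y {x} ∧ x ∉ core ∧ y ∉ insert x core ∧ next y = x ∧ next x = u := by
  obtain ⟨S', rfl, hS', hy, h⟩ := h.exists_of_card_eq_succ hS
  obtain ⟨S'', rfl, hS'', hx, h⟩ := h.exists_of_card_eq_succ hS'
  obtain rfl := Finset.card_eq_zero.1 hS''
  exact ⟨next y, rfl, by simpa using hx, by simpa using hy, rfl, h.eq_of_empty⟩

theorem IsArc.mem_union (h : IsArc core next u S y) (hu : u ∈ core) : y ∈ S ∪ core := by
  cases h with
  | nil => exact Finset.mem_union_right _ hu
  | cons => exact Finset.mem_union_left _ (Finset.mem_insert_self _ _)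

theorem IsArc.next_mem_union (h : IsArc core next u S y) (hu : u ∈ core) :
    ∀ x ∈ S, next x ∈ S ∪ core := by
  induction h with
  | nil => simp
  | cons h _ ih =>
    rw [Finset.insert_union, Finset.forall_mem_insert]
    exact ⟨Finset.mem_insert_of_mem (h.mem_union hu),
      fun x hx => Finset.mem_insert_of_mem (ih x hx)⟩

theorem GrowsTo.next_mem_union (h : GrowsTo core next S T) (hS : ∀ x ∈ S, next x ∈ S ∪ core) :
    ∀ x ∈ T, next x ∈ T ∪ core := by
  induction h with
  | refl => exact hS
  | insert _ _ hnext ih =>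
    rw [Finset.insert_union, Finset.forall_mem_insert]
    exact ⟨Finset.mem_insert_of_mem hnext, fun x hx => Finset.mem_insert_of_mem (ih x hx)⟩

theorem GrowsTo.subset (h : GrowsTo core next S T) : S ⊆ T := by
  induction h with
  | refl => exact subset_rfl
  | insert _ _ _ ih => exact ih.trans (Finset.subset_insert _ _)

theorem GrowsTo.disjoint (h : GrowsTo core next S T) (hS : Disjoint S core) : Disjoint T core := by
  induction h with
  | refl => exact hS
  | insert _ hy _ ih =>
    exact Finset.disjoint_insert_left.2 ⟨fun h => hy (Finset.mem_union_right _ h), ih⟩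

theorem growsTo_compl [Fintype V] (hS : Disjoint S core)
    (hr : ∀ x ∉ S ∪ core, r (next x) < r x) : GrowsTo core next S coreᶜ := by
  obtain ⟨T, hT, hmax⟩ := (Set.toFinite {T | GrowsTo core next S T}).exists_maximal ⟨S, .refl⟩
  suffices hcover : ∀ x, x ∈ T ∪ core by
    have hcompl : IsCompl T core :=
      ⟨hT.disjoint hS, codisjoint_iff.2 (Finset.eq_univ_of_forall hcover)⟩
    exact hcompl.eq_compl ▸ hT
  by_contra! hcover
  obtain ⟨y, hy, hmin⟩ := Set.exists_min_image {x | x ∉ T ∪ core} r (Set.toFinite _) hcover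
  have hnext : next y ∈ T ∪ core := by
    by_contra hnext
    have hyS : y ∉ S ∪ core := fun h => hy (Finset.union_subset_union_left hT.subset h)
    exact (hr y hyS).not_ge (hmin _ hnext)
  have hle := hmax (hT.insert hy hnext) (Finset.subset_insert _ _)
  exact hy (Finset.mem_union_left _ (hle (Finset.mem_insert_self _ _)))

end Growth

section GapPositivity

variable {V : Type*} [Fintype V] [DecidableEq V] {u v w y z : V} {next : V → V} {S T : Finset V}

theorem IsArc.posUpTo_foldGap_of_notMem (huv : u ≠ v) (hvw : v ≠ w) (huw : u ≠ w)
    (h : IsArc {u, v, w} next u S y) (hS : S.Nonempty) (hz : z ∉ S ∪ {u, v, w}) {σ : ℝ[X]}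
    (hσ : σ * σ = 1) (a : V → ℕ) :
    PosUpTo (S.card + 2) (foldGap X u v w (edgeSum ℝ[X] next S + signedEdge σ w z) a) := by
  induction h generalizing a with
  | nil => exact absurd hS Finset.not_nonempty_empty
  | @cons S y h hy ih =>
    obtain ⟨hyS, hyB⟩ := Finset.notMem_union.1 hy
    rw [Finset.insert_union, Finset.mem_insert, not_or] at hz
    rw [Finset.card_insert_of_notMem hyS]
    rcases S.eq_empty_or_nonempty with rfl | hS
    · rw [insert_empty_eq,
        foldGap_path_five X huv hvw huw hyB (by simpa using hz) h.eq_of_empty hσ]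
      exact posUpTo_pathGap (offMass_pos _ a) _ _ _ _ _
    · have hu : u ∈ ({u, v, w} : Finset V) := by simp
      rw [foldGap_insert_leaf X huv hvw huw (h.next_mem_union hu) hy (h.mem_union hu) hz.1]
      exact (ih hS hz.2 a).add_X_mul (by omega) (ih hS hz.2 _)

theorem IsArc.pentagonShape_foldGap (huv : u ≠ v) (hvw : v ≠ w) (huw : u ≠ w)
    (h : IsArc {u, v, w} next u S y) (hS : S.card = 2) (a : V → ℕ) :
    PentagonShape (S ∪ {u, v, w}) a S.card
      (foldGap X u v w (edgeSum ℝ[X] next S + signedEdge 1 w y) a) := by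
  rw [hS]
  obtain ⟨x, rfl, hx, hy, hyx, hxu⟩ := h.exists_of_card_eq_two hS
  rw [Finset.insert_union, Finset.singleton_union]
  exact pentagonShape_pentagon huv hvw huw hx hy hyx hxu a

theorem IsArc.posUpTo_foldGap_of_card_eq_two (huv : u ≠ v) (hvw : v ≠ w) (huw : u ≠ w)
    (h : IsArc {u, v, w} next u S y) (hS : S.card = 2) (a : V → ℕ) :
    PosUpTo (S.card + 2) (foldGap X u v w (edgeSum ℝ[X] next S + signedEdge (-1) w y) a) := by
  rw [hS]
  obtain ⟨x, rfl, hx, hy, hyx, hxu⟩ := h.exists_of_card_eq_two hS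
  rw [foldGap_pentagon X huv hvw huw hx hy hyx hxu (by norm_num)]
  exact (posUpTo_pathGap (offMass_pos _ a) _ _ _ _ _).add_X_mul (by norm_num)
    (posUpTo_squareGap (offMass_pos _ a) _ _ _ _)

theorem IsArc.posUpTo_foldGap (huv : u ≠ v) (hvw : v ≠ w) (huw : u ≠ w)
    (h : IsArc {u, v, w} next u S y) (hS : 2 ≤ S.card) {σ : ℝ[X]} (hσ : σ * σ = 1) (a : V → ℕ)
    (hσa : σ = (-1) ^ (S.card + 1) ∨ 4 ≤ a y + S.card) :
    PosUpTo (S.card + 2) (foldGap X u v w (edgeSum ℝ[X] next S + signedEdge σ w y) a) := by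
  obtain ⟨n, hn⟩ := Nat.exists_eq_add_of_le hS
  induction n generalizing S y σ a with
  | zero =>
    rcases mul_self_eq_one_iff.1 hσ with rfl | rfl
    · have ha : 4 ≤ a y + 2 := by
        rw [hn] at hσa
        exact hσa.resolve_left (by norm_num)
      have hy : y ∈ S ∪ {u, v, w} := h.mem_union (by simp)
      have hle := Finset.single_le_sum (fun z _ => Nat.zero_le (a z)) hy
      exact (h.pentagonShape_foldGap huv hvw huw hn a).posUpTo (by omega)
    · exact h.posUpTo_foldGap_of_card_eq_two huv hvw huw hn a
  | succ n ih =>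
    have hu : u ∈ ({u, v, w} : Finset V) := by simp
    obtain ⟨S', rfl, hS', hy, h⟩ := h.exists_of_card_eq_succ (n := 2 + n) hn
    have hne : next y ≠ y := fun hyn => hy (hyn ▸ h.mem_union hu)
    have hnonempty : S'.Nonempty := Finset.card_pos.1 (by omega)
    have hσa' : -σ = (-1) ^ (S'.card + 1) ∨ 4 ≤ merge y (next y) a (next y) + S'.card := by
      refine hσa.imp (fun hσ => ?_) fun ha => ?_
      · rw [hσ, hn, hS', ← add_assoc, pow_succ]
        ring
      · rw [merge, Function.update_of_ne hne, Function.update_self]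
        omega
    rw [hn, ← add_assoc, ← hS', add_right_comm,
      foldGap_insert_end X huv hvw huw (h.next_mem_union hu) hy (h.mem_union hu)]
    exact (h.posUpTo_foldGap_of_notMem huv hvw huw hnonempty hy hσ a).add_X_mul (by omega)
      (ih h (by omega) (by simpa using hσ) _ hσa' hS')

theorem GrowsTo.posUpTo_foldGap (huv : u ≠ v) (hvw : v ≠ w) (huw : u ≠ w)
    (h : GrowsTo {u, v, w} next S T) (hS : ∀ x ∈ S, next x ∈ S ∪ {u, v, w})
    (hz : z ∈ S ∪ {u, v, w}) {σ : ℝ[X]}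
    (hpos : ∀ a, PosUpTo (S.card + 2) (foldGap X u v w (edgeSum ℝ[X] next S + signedEdge σ w z) a))
    (a : V → ℕ) :
    PosUpTo (T.card + 2) (foldGap X u v w (edgeSum ℝ[X] next T + signedEdge σ w z) a) := by
  induction h generalizing a with
  | refl => exact hpos a
  | @insert T y h hy hnext ih =>
    have hzy : z ≠ y := fun hzy => hy (hzy ▸ Finset.union_subset_union_left h.subset hz)
    rw [Finset.card_insert_of_notMem (Finset.notMem_union.1 hy).1,
      foldGap_insert_leaf X huv hvw huw (h.next_mem_union hS) hy hnext hzy]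
    exact (ih a).add_X_mul (by omega) (ih _)

theorem GrowsTo.pentagonShape (huv : u ≠ v) (hvw : v ≠ w) (huw : u ≠ w)
    (h : GrowsTo {u, v, w} next S T) (hcard : 2 ≤ S.card) (hS : ∀ x ∈ S, next x ∈ S ∪ {u, v, w})
    (hz : z ∈ S ∪ {u, v, w})
    (hshape : ∀ a, PentagonShape (S ∪ {u, v, w}) a S.card
      (foldGap X u v w (edgeSum ℝ[X] next S + signedEdge 1 w z) a)) (a : V → ℕ) :
    PentagonShape (T ∪ {u, v, w}) a T.card
      (foldGap X u v w (edgeSum ℝ[X] next T + signedEdge 1 w z) a) := by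
  induction h generalizing a with
  | refl => exact hshape a
  | @insert T y h hy hnext ih =>
    have hzy : z ≠ y := fun hzy => hy (hzy ▸ Finset.union_subset_union_left h.subset hz)
    rw [Finset.card_insert_of_notMem (Finset.notMem_union.1 hy).1, Finset.insert_union,
      foldGap_insert_leaf X huv hvw huw (h.next_mem_union hS) hy hnext hzy]
    exact (ih a).add_X_mul (hcard.trans (Finset.card_le_card h.subset)) hy hnext (ih _)

theorem PentagonShape.posUpTo_of_mass_eq_zero {n : ℕ} {f : ℝ[X]} (hf : PentagonShape T 0 n f)
    (hn : 3 ≤ n) : PosUpTo (if n = 3 then 4 else n + 2) f := by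
  split_ifs with h3
  · obtain ⟨h, hpos, -, rfl⟩ := hf
    subst h3
    simpa using hpos
  · exact hf.posUpTo (by omega)

theorem IsArc.posUpTo_foldGap_compl (huv : u ≠ v) (hvw : v ≠ w) (huw : u ≠ w)
    (h : IsArc {u, v, w} next u S y) (hgrow : GrowsTo {u, v, w} next S {u, v, w}ᶜ)
    (hS : 2 ≤ S.card) (hn : 6 ≤ Fintype.card V) :
    PosUpTo (if Fintype.card V = 6 ∧ S.card = 2 then 4 else Fintype.card V - 1)
      (foldGap X u v w (edgeSum ℝ[X] next {u, v, w}ᶜ + signedEdge 1 w y) 0) := by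
  have hu : u ∈ ({u, v, w} : Finset V) := by simp
  have hcard : ({u, v, w}ᶜ : Finset V).card = Fintype.card V - 3 := by
    rw [Finset.card_compl, Finset.card_eq_three.2 ⟨u, v, w, huv, huw, hvw, rfl⟩]
  rcases hS.eq_or_lt with hS2 | hS3
  · have hshape := hgrow.pentagonShape huv hvw huw hS (h.next_mem_union hu) (h.mem_union hu)
      (h.pentagonShape_foldGap huv hvw huw hS2.symm) 0
    convert hshape.posUpTo_of_mass_eq_zero (by omega) using 1
    split_ifs <;> omega
  · rw [if_neg (by omega), show Fintype.card V - 1 = ({u, v, w}ᶜ : Finset V).card + 2 by omega]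
    refine hgrow.posUpTo_foldGap huv hvw huw (h.next_mem_union hu) (h.mem_union hu) (fun a => ?_) 0
    refine h.posUpTo_foldGap huv hvw huw hS (one_mul 1) a ?_
    rcases hS3.nat_succ_le.eq_or_lt with hS3 | hS4
    · exact .inl (by rw [← hS3]; norm_num)
    · exact .inr (by omega)

end GapPositivity

section Orientation

variable {V : Type*} {G : SimpleGraph V} {next : V → V} {u v w x y : V}

/-- The edges of `G` are the pairs `s(x, next x)`, each obtained from exactly one vertex `x`. A
finite connected graph has such an orientation if and only if it is unicyclic. -/
structure Orients (G : SimpleGraph V) (next : V → V) : Prop where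
  adj_iff : ∀ x y, G.Adj x y ↔ next x = y ∨ next y = x
  next_next_ne : ∀ x, next (next x) ≠ x

theorem Orients.adj_next (h : Orients G next) (x : V) : G.Adj x (next x) :=
  (h.adj_iff _ _).2 (.inl rfl)

theorem Orients.of_ncard_edgeSet [Fintype V] (hG : G.edgeSet.ncard = Fintype.card V)
    (hadj : ∀ x, G.Adj x (next x)) (hne : ∀ x, next (next x) ≠ x) : Orients G next := by
  refine ⟨fun x y => ⟨fun hxy => ?_, ?_⟩, hne⟩
  · have hinj : Function.Injective fun x => s(x, next x) := by
      intro x y hxy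
      rcases Sym2.eq_iff.1 hxy with h | ⟨hx, hy⟩
      · exact h.1
      · exact absurd (by rw [hy, hx]) (hne x)
    have hrange : Set.range (fun x => s(x, next x)) = G.edgeSet := by
      refine Set.eq_of_subset_of_ncard_le (Set.range_subset_iff.2 hadj) ?_ (Set.toFinite _)
      rw [hG, ← Set.image_univ, Set.ncard_image_of_injective _ hinj, Set.ncard_univ,
        Nat.card_eq_fintype_card]
    obtain ⟨z, hz⟩ : s(x, y) ∈ Set.range fun x => s(x, next x) := hrange ▸ hxy
    rcases Sym2.eq_iff.1 hz with ⟨rfl, h⟩ | ⟨rfl, h⟩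
    · exact .inl h
    · exact .inr h
  · rintro (rfl | rfl)
    · exact hadj x
    · exact (hadj y).symm

theorem Orients.degree_eq [Fintype V] [DecidableEq V] [DecidableRel G.Adj] (h : Orients G next)
    (x : V) :
    G.degree x = 1 + (Finset.univ.filter fun y => next y = x).card := by
  have hnbr : G.neighborFinset x = insert (next x) (Finset.univ.filter fun y => next y = x) := by
    ext y
    simp [h.adj_iff, eq_comm]
  rw [← SimpleGraph.card_neighborFinset_eq_degree, hnbr,
    Finset.card_insert_of_notMem (by simpa using h.next_next_ne x), add_comm]

theorem Orients.signlessLapMatrix_map [Fintype V] [DecidableEq V] (h : Orients G next) :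
    G.signlessLapMatrix.map (C : ℝ →+* ℝ[X]) = edgeSum ℝ[X] next Finset.univ := by
  ext1 x y
  have hterm (z : V) : (signedEdge 1 z (next z) : Matrix V V ℝ[X]) x y =
      (if z = x then if next x = y then 1 else 0 else 0) +
        (if z = y then if next y = x then 1 else 0 else 0) +
        if x = y then (if z = x then 1 else 0) + (if next z = x then 1 else 0) else 0 := by
    have hne := h.next_next_ne z
    simp only [signedEdge, vecMulVec_apply, Pi.add_apply, Pi.single_apply]
    grind
  rw [edgeSum, Matrix.sum_apply, Finset.sum_congr rfl fun z _ => hterm z]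
  have hne := h.next_next_ne
  rcases eq_or_ne x y with rfl | hxy
  · classical
    have hx : next x ≠ x := fun hx => hne x (by rw [hx, hx])
    simp [SimpleGraph.signlessLapMatrix, Finset.sum_add_distrib, h.degree_eq, hx,
      SimpleGraph.degMatrix]
  · have hyx : next x = y → next y ≠ x := fun h => h ▸ hne x
    have hadj := h.adj_iff x y
    simp [SimpleGraph.signlessLapMatrix, Finset.sum_add_distrib, SimpleGraph.degMatrix, hxy]
    grind

theorem Orients.coeff_lapDet [Fintype V] [DecidableEq V] (h : Orients G next) {i : ℕ}
    (hi : i ≤ Fintype.card V) :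
    (lapDet X (edgeSum ℝ[X] next Finset.univ) 0).coeff i = G.signlessLapCoeff i := by
  have hrev : lapDet X (edgeSum ℝ[X] next Finset.univ) 0 =
      G.signlessLapMatrix.charpolyRev.comp (C (-1) * X) := by
    rw [← h.signlessLapMatrix_map, charpolyRev, ← coe_compRingHom_apply, RingHom.map_det, lapDet]
    congr 1
    ext1 x y
    rcases eq_or_ne x y with rfl | hxy
    · simp
    · simp [hxy]
  classical
  rw [hrev, SimpleGraph.signlessLapCoeff, ← reverse_charpoly, comp_C_mul_X_coeff, coeff_reverse,
    charpoly_natDegree_eq_dim, revAt_le hi, mul_comm]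
  congr!

theorem mk_mem_setOf_exists_mk_iff {T : Set V} {a : V} :
    s(x, y) ∈ {e | ∃ z ∈ T, e = s(a, z)} ↔ (x = a ∧ y ∈ T) ∨ (y = a ∧ x ∈ T) := by
  simp only [Set.mem_ofPred_eq, Sym2.eq_iff]
  grind

/-- The orientation of `moveBranches G u v w` obtained from an orientation of `G` in which
`u v w` is a directed path. -/
def moveNext [DecidableEq V] (next : V → V) (u v w x : V) : V :=
  if x = w then v else if x = v then u else if x = u then next w else foldVertex u v w (next x)

theorem Orients.moveBranches [DecidableEq V] (h : Orients G next) (huw : u ≠ w) (hu : next u = v)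
    (hv : next v = w) (hw : next w ∉ ({u, v, w} : Finset V))
    (hww : next (next w) ∉ ({u, v, w} : Finset V)) :
    Orients (G.moveBranches u v w) (moveNext next u v w) := by
  have huv : u ≠ v := hu ▸ (h.adj_next u).ne
  have hvw : v ≠ w := hv ▸ (h.adj_next v).ne
  simp only [Finset.mem_insert, Finset.mem_singleton, not_or] at hw hww
  have hne := h.next_next_ne
  refine ⟨fun x y => ?_, fun x => ?_⟩
  · rw [SimpleGraph.moveBranches, SimpleGraph.sup_adj, SimpleGraph.deleteEdges_adj,
      SimpleGraph.fromEdgeSet_adj, Set.mem_union, Set.mem_union]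
    simp only [mk_mem_setOf_exists_mk_iff]
    simp only [Set.mem_sdiff, SimpleGraph.mem_neighborSet,
      Set.mem_insert_iff, Set.mem_singleton_iff, h.adj_iff, moveNext, foldVertex]
    have := hne x
    have := hne y
    grind
  · have := hne x
    simp only [moveNext, foldVertex]
    grind

end Orientation

section Cycle

variable {V : Type*} {G : SimpleGraph V} {next : V → V} {v x y : V} {p : G.Walk v v}

theorem exists_getVert_eq_of_mem_support (hp : p.IsCycle) (hx : x ∈ p.support) :
    ∃ i < p.length, p.getVert i = x := by
  obtain ⟨i, rfl, hi⟩ := SimpleGraph.Walk.mem_support_iff_exists_getVert.1 hx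
  rcases hi.lt_or_eq with hi | rfl
  · exact ⟨i, hi, rfl⟩
  · exact ⟨0, (Nat.zero_lt_of_lt hp.three_le_length), by simp⟩

theorem getVert_inj (hp : p.IsCycle) {i j : ℕ} (hi : i < p.length) (hj : j < p.length) :
    p.getVert i = p.getVert j ↔ i = j :=
  hp.getVert_injOn'.eq_iff (Nat.le_sub_one_of_lt hi) (Nat.le_sub_one_of_lt hj)

theorem getVert_notMem [DecidableEq V] (hp : p.IsCycle) {k : ℕ} (hk : 2 ≤ k)
    (hk' : k < p.length - 1) : p.getVert k ∉ ({p.penultimate, v, p.snd} : Finset V) := by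
  have hlt : k < p.length := by omega
  simp only [Finset.mem_insert, Finset.mem_singleton, hp.getVert_endpoint_iff hlt.le,
    SimpleGraph.Walk.snd, SimpleGraph.Walk.penultimate]
  rw [getVert_inj hp hlt (by omega), getVert_inj hp hlt (by omega)]
  omega

theorem card_image_getVert_Ico [DecidableEq V] (hp : p.IsCycle) (k : ℕ) :
    ((Finset.Ico k (p.length - 1)).image p.getVert).card = p.length - 1 - k := by
  rw [Finset.card_image_of_injOn, Nat.card_Ico]
  intro i hi j hj hij
  simp only [Finset.coe_Ico, Set.mem_Ico] at hi hj
  exact (getVert_inj hp (by omega) (by omega)).1 hij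

theorem exists_adj_dist_lt (hG : G.Connected) (hx : x ≠ v) :
    ∃ y, G.Adj x y ∧ G.dist y v < G.dist x v := by
  obtain ⟨q, hq⟩ := hG.exists_walk_length_eq_dist x v
  have hnil : ¬ q.Nil := SimpleGraph.Walk.not_nil_of_ne hx
  refine ⟨q.snd, q.adj_snd hnil, ?_⟩
  have h := q.length_tail_add_one hnil
  have := SimpleGraph.dist_le q.tail
  omega

/-- The orientation of a unicyclic graph that runs around the cycle `p` and, outside of it, towards
the start `v` of `p`. -/
structure OrientsToward (p : G.Walk v v) (next : V → V) : Prop extends Orients G next where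
  next_getVert : ∀ i < p.length, next (p.getVert i) = p.getVert (i + 1)
  dist_next_lt : ∀ x ∉ p.support, G.dist (next x) v < G.dist x v

theorem exists_orientsToward [Fintype V] (hG : G.IsUnicyclic) (hp : p.IsCycle) :
    ∃ next, OrientsToward p next := by
  have hex (x : V) : ∃ y, G.Adj x y ∧ (∀ i < p.length, p.getVert i = x → y = p.getVert (i + 1)) ∧
      (x ∉ p.support → G.dist y v < G.dist x v) := by
    by_cases hx : x ∈ p.support
    · obtain ⟨i, hi, rfl⟩ := exists_getVert_eq_of_mem_support hp hx
      exact ⟨_, p.adj_getVert_succ hi, fun j hj h => by rw [(getVert_inj hp hj hi).1 h],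
        fun h => absurd hx h⟩
    · have hxv : x ≠ v := fun h => hx (h ▸ p.start_mem_support)
      obtain ⟨y, hxy, hy⟩ := exists_adj_dist_lt hG.1 hxv
      exact ⟨y, hxy, fun i _ h => absurd (h ▸ p.getVert_mem_support i) hx, fun _ => hy⟩
  choose next hadj hnext hdist using hex
  have hcycle (i : ℕ) (hi : i < p.length) : next (p.getVert i) = p.getVert (i + 1) :=
    hnext _ i hi rfl
  have hsupport {x : V} (hx : x ∈ p.support) : next x ∈ p.support := by
    obtain ⟨i, hi, rfl⟩ := exists_getVert_eq_of_mem_support hp hx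
    exact hcycle i hi ▸ p.getVert_mem_support _
  refine ⟨next, .of_ncard_edgeSet hG.2 hadj fun x hx => ?_, hcycle, hdist⟩
  by_cases hxp : x ∈ p.support
  · obtain ⟨i, hi, rfl⟩ := exists_getVert_eq_of_mem_support hp hxp
    have hlen := hp.three_le_length
    rw [hcycle i hi] at hx
    rcases (by omega : i + 2 < p.length ∨ i + 2 = p.length ∨ i + 1 = p.length) with hi' | hi' | hi'
    · rw [hcycle (i + 1) (by omega), getVert_inj hp hi' hi] at hx
      omega
    · rw [hcycle (i + 1) (by omega), hi', p.getVert_length, eq_comm,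
        hp.getVert_endpoint_iff hi.le] at hx
      omega
    · have h₀ : next v = p.getVert 1 := by simpa using hcycle 0 (by omega)
      rw [hi', p.getVert_length, h₀, getVert_inj hp (by omega) hi] at hx
      omega
  · have hnxp : next x ∉ p.support := fun h => hxp (hx ▸ hsupport h)
    have h1 := hdist x hxp
    have h2 := hdist (next x) hnxp
    rw [hx] at h2
    exact h1.asymm h2

namespace OrientsToward

theorem next_start (h : OrientsToward p next) (hp : p.IsCycle) : next v = p.snd := by
  simpa using h.next_getVert 0 (Nat.zero_lt_of_lt hp.three_le_length)

theorem next_penultimate (h : OrientsToward p next) (hp : p.IsCycle) :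
    next p.penultimate = v := by
  have hlen := hp.three_le_length
  rw [SimpleGraph.Walk.penultimate, h.next_getVert _ (by omega), Nat.sub_add_cancel (by omega),
    p.getVert_length]

theorem next_mem_support (h : OrientsToward p next) (hp : p.IsCycle) (hx : x ∈ p.support) :
    next x ∈ p.support := by
  obtain ⟨i, hi, rfl⟩ := exists_getVert_eq_of_mem_support hp hx
  exact h.next_getVert i hi ▸ p.getVert_mem_support _

theorem mem_support_of_onCycle [Finite V] (h : OrientsToward p next) (hp : p.IsCycle)
    (hx : G.OnCycle x) : x ∈ p.support := by
  classical
  obtain ⟨c, hc⟩ := hx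
  by_contra hxp
  obtain ⟨z, ⟨hzc, hzp⟩, hmax⟩ := Set.exists_max_image {z | z ∈ c.support ∧ z ∉ p.support}
    (G.dist · v) (Set.toFinite _) ⟨x, c.start_mem_support, hxp⟩
  have hnext {a : V} (ha : a ∈ (c.rotate z hzc).support) (hadj : G.Adj z a) : next z = a := by
    refine ((h.adj_iff z a).1 hadj).resolve_right fun haz => ?_
    have hap : a ∉ p.support := fun hap => hzp (haz ▸ h.next_mem_support hp hap)
    have hlt := h.dist_next_lt a hap
    rw [haz] at hlt
    exact hlt.not_ge (hmax a ⟨(c.mem_support_rotate_iff z hzc).1 ha, hap⟩)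
  have hc' := hc.rotate hzc
  have hsnd := hnext (SimpleGraph.Walk.getVert_mem_support _ _)
    (SimpleGraph.Walk.adj_snd hc'.not_nil)
  have hpenultimate := hnext (SimpleGraph.Walk.getVert_mem_support _ _)
    (SimpleGraph.Walk.adj_penultimate hc'.not_nil).symm
  exact hc'.snd_ne_penultimate (hsnd.symm.trans hpenultimate)

theorem eq_snd_or_eq_penultimate (h : OrientsToward p next) (hp : p.IsCycle) (hx : x ∈ p.support)
    (hadj : G.Adj v x) : x = p.snd ∨ x = p.penultimate := by
  rcases (h.adj_iff v x).1 hadj with hvx | hxv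
  · exact .inl (hvx.symm.trans (h.next_start hp))
  · obtain ⟨i, hi, rfl⟩ := exists_getVert_eq_of_mem_support hp hx
    refine .inr (congrArg p.getVert (Nat.le_sub_one_of_lt hi |>.antisymm ?_))
    by_contra! hlt
    rw [h.next_getVert i hi, hp.getVert_endpoint_iff hi] at hxv
    omega

variable [DecidableEq V]

theorem next_snd_notMem (h : OrientsToward p next) (hp : p.IsCycle) (hlen : 5 ≤ p.length) :
    next p.snd ∉ ({p.penultimate, v, p.snd} : Finset V) := by
  rw [SimpleGraph.Walk.snd, h.next_getVert 1 (by omega)]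
  exact getVert_notMem hp le_rfl (by omega)

theorem next_next_snd_notMem (h : OrientsToward p next) (hp : p.IsCycle) (hlen : 5 ≤ p.length) :
    next (next p.snd) ∉ ({p.penultimate, v, p.snd} : Finset V) := by
  rw [SimpleGraph.Walk.snd, h.next_getVert 1 (by omega), h.next_getVert 2 (by omega)]
  exact getVert_notMem hp (by omega) (by omega)

theorem orients_moveBranches (h : OrientsToward p next) (hp : p.IsCycle) (hlen : 5 ≤ p.length) :
    Orients (G.moveBranches p.penultimate v p.snd) (moveNext next p.penultimate v p.snd) :=
  h.moveBranches hp.snd_ne_penultimate.symm (h.next_penultimate hp) (h.next_start hp)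
    (h.next_snd_notMem hp hlen) (h.next_next_snd_notMem hp hlen)

theorem isArc (h : OrientsToward p next) (hp : p.IsCycle) {k : ℕ} (hk : 2 ≤ k)
    (hk' : k ≤ p.length - 1) :
    IsArc {p.penultimate, v, p.snd} next p.penultimate
      ((Finset.Ico k (p.length - 1)).image p.getVert) (p.getVert k) := by
  induction hk' using Nat.decreasingInduction with
  | self =>
    rw [Finset.Ico_self, Finset.image_empty]
    exact .nil
  | of_succ k hk' ih =>
    have hlt : k < p.length := by omega
    rw [← Finset.insert_Ico_add_one_left_eq_Ico hk', Finset.image_insert]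
    refine .cons (by rw [h.next_getVert k hlt]; exact ih (by omega)) ?_
    rw [Finset.mem_union, not_or]
    refine ⟨fun hmem => ?_, getVert_notMem hp hk hk'⟩
    obtain ⟨j, hj, hjk⟩ := Finset.mem_image.1 hmem
    rw [Finset.mem_Ico] at hj
    rw [getVert_inj hp (by omega) hlt] at hjk
    omega

theorem growsTo [Fintype V] (h : OrientsToward p next) (hp : p.IsCycle) :
    GrowsTo {p.penultimate, v, p.snd} next ((Finset.Ico 2 (p.length - 1)).image p.getVert)
      {p.penultimate, v, p.snd}ᶜ := by
  have hlen := hp.three_le_length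
  refine growsTo_compl (r := (G.dist · v)) (h.isArc hp le_rfl (by omega)).disjoint
    fun x hx => h.dist_next_lt x fun hxp => hx ?_
  obtain ⟨i, hi, rfl⟩ := exists_getVert_eq_of_mem_support hp hxp
  obtain rfl | rfl | rfl | hi' :
      i = 0 ∨ i = 1 ∨ i = p.length - 1 ∨ (2 ≤ i ∧ i < p.length - 1) := by omega
  · simp
  · simp [SimpleGraph.Walk.snd]
  · simp [SimpleGraph.Walk.penultimate]
  · exact Finset.mem_union_left _ (Finset.mem_image_of_mem _ (Finset.mem_Ico.2 hi'))

end OrientsToward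

theorem exists_isCycle_length_eq_girth [Fintype V] {u v w : V} (hG : G.IsUnicyclic)
    (hu : G.OnCycle u) (hv : G.OnCycle v) (hw : G.OnCycle w) (huv : G.Adj u v) (hvw : G.Adj v w)
    (huw : u ≠ w) :
    ∃ p : G.Walk v v, p.IsCycle ∧ p.length = G.girth ∧ p.snd = w ∧ p.penultimate = u := by
  classical
  have hcyclic : ¬ G.IsAcyclic := fun h => hv.elim fun c hc => h c hc
  obtain ⟨z, c, hc, hlen⟩ := SimpleGraph.exists_girth_eq_length.2 hcyclic
  obtain ⟨next, hnext⟩ := exists_orientsToward hG hc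
  have hvc := hnext.mem_support_of_onCycle hc hv
  have hp := hc.rotate hvc
  obtain ⟨next', hnext'⟩ := exists_orientsToward hG hp
  have hu' := hnext'.eq_snd_or_eq_penultimate hp (hnext'.mem_support_of_onCycle hp hu) huv.symm
  have hw' := hnext'.eq_snd_or_eq_penultimate hp (hnext'.mem_support_of_onCycle hp hw) hvw
  have hplen : (c.rotate v hvc).length = G.girth := by rw [SimpleGraph.Walk.length_rotate, hlen]
  rcases hw' with hw' | hw'
  · exact ⟨_, hp, hplen, hw'.symm, (hu'.resolve_left fun h => huw (h.trans hw'.symm)).symm⟩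
  · refine ⟨_, hp.reverse, by rw [SimpleGraph.Walk.length_reverse, hplen], ?_, ?_⟩
    · rw [SimpleGraph.Walk.snd_reverse, hw']
    · rw [SimpleGraph.Walk.penultimate_reverse]
      exact (hu'.resolve_right fun h => huw (h.trans hw'.symm)).symm

end Cycle

section Comparison

variable {V : Type*} [Fintype V] {G : SimpleGraph V} {next : V → V} {u v w : V}

theorem signlessLapCoeff_zero (G : SimpleGraph V) : G.signlessLapCoeff 0 = 1 := by
  classical
  rw [SimpleGraph.signlessLapCoeff, Nat.sub_zero, pow_zero, one_mul]
  simpa using (charpoly_monic G.signlessLapMatrix).coeff_natDegree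

theorem signlessLapCoeff_one [Nonempty V] [DecidableRel G.Adj] :
    G.signlessLapCoeff 1 = (∑ x, G.degree x : ℕ) := by
  classical
  rw [SimpleGraph.signlessLapCoeff, pow_one, neg_one_mul,
    ← trace_eq_neg_charpoly_coeff G.signlessLapMatrix, SimpleGraph.signlessLapMatrix, trace_add,
    SimpleGraph.trace_adjMatrix, add_zero, SimpleGraph.degMatrix, trace_diagonal, Nat.cast_sum]
  congr!

theorem Orients.sum_degree [DecidableRel G.Adj] (h : Orients G next) :
    ∑ x, G.degree x = 2 * Fintype.card V := by
  classical
  simp only [h.degree_eq, Finset.sum_add_distrib]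
  rw [← Finset.card_eq_sum_card_fiberwise (fun x _ => Finset.mem_univ (next x))]
  simp [two_mul]

theorem Orients.signlessLapCoeff_eq_of_le_one [Nonempty V] {G' : SimpleGraph V} {next' : V → V}
    (h : Orients G next) (h' : Orients G' next') {i : ℕ} (hi : i ≤ 1) :
    G.signlessLapCoeff i = G'.signlessLapCoeff i := by
  classical
  obtain rfl | rfl : i = 0 ∨ i = 1 := by omega
  · rw [signlessLapCoeff_zero, signlessLapCoeff_zero]
  · rw [signlessLapCoeff_one, signlessLapCoeff_one, h.sum_degree, h'.sum_degree]

variable [DecidableEq V]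

theorem edgeSum_univ (R : Type*) [CommRing R] (huv : u ≠ v) (hvw : v ≠ w) (huw : u ≠ w)
    (hu : next u = v) (hv : next v = w) :
    edgeSum R next Finset.univ =
      basePath R u v w + (edgeSum R next {u, v, w}ᶜ + signedEdge 1 w (next w)) := by
  rw [edgeSum, ← Finset.sum_add_sum_compl {u, v, w}, Finset.sum_insert (by simp [huv, huw]),
    Finset.sum_pair hvw, hu, hv, basePath, edgeSum]
  abel

theorem edgeSum_moveNext (R : Type*) [CommRing R] (huv : u ≠ v) (hvw : v ≠ w) (huw : u ≠ w)
    (hw : next w ∉ ({u, v, w} : Finset V)) :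
    edgeSum R (moveNext next u v w) Finset.univ = basePath R u v w + foldMatrix R u v w *
      (edgeSum R next {u, v, w}ᶜ + signedEdge 1 w (next w)) * (foldMatrix R u v w)ᵀ := by
  have hcompl : edgeSum R (moveNext next u v w) {u, v, w}ᶜ =
      foldMatrix R u v w * edgeSum R next {u, v, w}ᶜ * (foldMatrix R u v w)ᵀ := by
    rw [edgeSum, edgeSum, Matrix.mul_sum, Matrix.sum_mul]
    refine Finset.sum_congr rfl fun x hx => ?_
    rw [Finset.mem_compl] at hx
    rw [foldMatrix_conj_signedEdge, foldVertex_of_notMem hx]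
    simp only [Finset.mem_insert, Finset.mem_singleton, not_or] at hx
    rw [moveNext, if_neg hx.2.2, if_neg hx.2.1, if_neg hx.1]
  have hedge : signedEdge 1 u (next w) = foldMatrix R u v w * signedEdge 1 w (next w) *
      (foldMatrix R u v w)ᵀ := by
    rw [foldMatrix_conj_signedEdge, foldVertex_of_notMem hw, foldVertex, if_pos (.inr rfl)]
  have hu : moveNext next u v w u = next w := by simp [moveNext, huv, huw]
  have hv : moveNext next u v w v = u := by simp [moveNext, hvw]
  have hw : moveNext next u v w w = v := by simp [moveNext]
  rw [mul_add, add_mul, ← hcompl, ← hedge, edgeSum, ← Finset.sum_add_sum_compl {u, v, w},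
    Finset.sum_insert (by simp [huv, huw]), Finset.sum_pair hvw, hu, hv, hw, basePath, edgeSum,
    signedEdge_comm v u, signedEdge_comm w v]
  abel

namespace OrientsToward

variable {p : G.Walk v v}

theorem coeff_foldGap (h : OrientsToward p next) (hp : p.IsCycle) (hlen : 5 ≤ p.length) {i : ℕ}
    (hi : i ≤ Fintype.card V) :
    (foldGap X p.penultimate v p.snd
      (edgeSum ℝ[X] next {p.penultimate, v, p.snd}ᶜ + signedEdge 1 p.snd (next p.snd)) 0).coeff i =
      G.signlessLapCoeff i - (G.moveBranches p.penultimate v p.snd).signlessLapCoeff i := by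
  have huv := (p.adj_penultimate hp.not_nil).ne
  have hvw := (p.adj_snd hp.not_nil).ne
  have huw := hp.snd_ne_penultimate.symm
  have hmass : foldMass p.penultimate v p.snd 0 = 0 := by
    funext x
    simp [foldMass]
  rw [← h.coeff_lapDet hi, ← (h.orients_moveBranches hp hlen).coeff_lapDet hi,
    edgeSum_univ _ huv hvw huw (h.next_penultimate hp) (h.next_start hp),
    edgeSum_moveNext _ huv hvw huw (h.next_snd_notMem hp hlen), foldGap, hmass, coeff_sub]

theorem posUpTo_foldGap (h : OrientsToward p next) (hp : p.IsCycle)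
    (hlen : 5 ≤ p.length) (hn : 6 ≤ Fintype.card V) :
    PosUpTo (if Fintype.card V = 6 ∧ p.length = 5 then 4 else Fintype.card V - 1)
      (foldGap X p.penultimate v p.snd
        (edgeSum ℝ[X] next {p.penultimate, v, p.snd}ᶜ + signedEdge 1 p.snd (next p.snd)) 0) := by
  have hcard := card_image_getVert_Ico hp 2
  have hpos := (h.isArc hp le_rfl (by omega)).posUpTo_foldGap_compl
    (p.adj_penultimate hp.not_nil).ne (p.adj_snd hp.not_nil).ne hp.snd_ne_penultimate.symm
    (h.growsTo hp) (by omega) hn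
  have hpentagon : p.length - 1 - 2 = 2 ↔ p.length = 5 := by omega
  rw [hcard, ← h.next_getVert 1 (by omega)] at hpos
  simpa only [hpentagon] using hpos

end OrientsToward

end Comparison

theorem theorem2p6_general {V : Type*} [Fintype V] (G : SimpleGraph V)
    (hn : 6 ≤ Fintype.card V) (hG : G.IsUnicyclic) (hg : 5 ≤ G.girth)
    (u v w : V) (hu : G.OnCycle u) (hv : G.OnCycle v) (hw : G.OnCycle w)
    (huv : G.Adj u v) (hvw : G.Adj v w) (huw : u ≠ w)
    (i : ℕ) (hi : i ≤ Fintype.card V) :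
    (G.moveBranches u v w).signlessLapCoeff i ≤ G.signlessLapCoeff i ∧
    (G.signlessLapCoeff i = (G.moveBranches u v w).signlessLapCoeff i ↔
      i = 0 ∨ i = 1 ∨ i = Fintype.card V ∨
        (Fintype.card V = 6 ∧ G.girth = 5 ∧ i = 5)) := by
  classical
  obtain ⟨p, hp, hlen, rfl, rfl⟩ := exists_isCycle_length_eq_girth hG hu hv hw huv hvw huw
  obtain ⟨next, h⟩ := exists_orientsToward hG hp
  have hp₅ : 5 ≤ p.length := hlen ▸ hg
  obtain ⟨hnonneg, hpos, hzero⟩ := h.posUpTo_foldGap hp hp₅ hn i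
  rw [h.coeff_foldGap hp hp₅ hi] at hnonneg hpos hzero
  refine ⟨sub_nonneg.1 hnonneg, fun heq => ?_, fun hcases => ?_⟩
  · by_contra! hne
    refine (hpos (by omega) ?_).ne' (sub_eq_zero.2 heq)
    split_ifs <;> omega
  · by_cases hi₁ : i ≤ 1
    · have : Nonempty V := ⟨v⟩
      exact h.signlessLapCoeff_eq_of_le_one (h.orients_moveBranches hp hp₅) hi₁
    · refine sub_eq_zero.1 (hzero ?_)
      split_ifs <;> omega

theorem theorem2p6 {V : Type*} [Fintype V] (G : SimpleGraph V)
    (hn : 6 ≤ Fintype.card V) (hG : G.IsUnicyclic) (hg : 5 ≤ G.girth)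
    (hpend : G.OnlyPendentPathsOnCycle 2)
    (u v w : V) (hu : G.OnCycle u) (hv : G.OnCycle v) (hw : G.OnCycle w)
    (huv : G.Adj u v) (hvw : G.Adj v w) (huw : u ≠ w)
    (i : ℕ) (hi : i ≤ Fintype.card V) :
    (G.moveBranches u v w).signlessLapCoeff i ≤ G.signlessLapCoeff i ∧
    (G.signlessLapCoeff i = (G.moveBranches u v w).signlessLapCoeff i ↔
      i = 0 ∨ i = 1 ∨ i = Fintype.card V ∨
        (Fintype.card V = 6 ∧ G.girth = 5 ∧ i = 5)) :=
  theorem2p6_general G hn hG hg u v w hu hv hw huv hvw huw i hi
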